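/- Let $\Bbbk$ be a commutative ring. An $A_\infty$-category $\mathcal A$ over $\Bbbk$ is given by its suspended graded quiver $s\mathcal A$, $(s\mathcal A)^d(X,Y)=\mathcal A^{d+1}(X,Y)$, with $\Bbbk$-linear operations $b_n:s\mathcal A(X_0,X_1)\otimes\cdots\otimes s\mathcal A(X_{n-1},X_n)\to s\mathcal A(X_0,X_n)$, $n\ge1$, of degree $1$, such that $\sum_{r+n+t=m}(1^{\otimes r}\otimes b_n\otimes1^{\otimes t})b_{r+1+t}=0$ for all $m\ge1$ (maps act on the right, with Koszul signs). A complex is contractible if its identity map is null-homotopic, and $\mathcal A$ is *contractible* if all complexes $(s\mathcal A(X,Y),b_1)$ are contractible. $A_\infty$-transformations $r:f\to g:\mathcal A\to\mathcal B$ are $(f,g)$-coderivations $Ts\mathcal A\to Ts\mathcal B$ of degree $-1$, given by components $r_n$, $n\ge0$. Put $vB_1=vb-(-1)^{\deg v}bv$ and $(r\otimes p)B_2=(r\otimes p)\theta b$ (in components), where $\theta$ has the terms $f\otimes\cdots\otimes f\otimes r_j\otimes g\otimes\cdots\otimes g\otimes p_t\otimes h\otimes\cdots\otimes h$ for $f\xrightarrow{r}g\xrightarrow{p}h$.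 A transformation $r$ is natural if $rB_1=0$; one writes $r\equiv p$ if $r-p=vB_1$ for some $(f,g)$-coderivation $v$ of degree $-2$. The $A_\infty$-category $\mathcal A$ is unital if it has a unit transformation, that is, a natural $A_\infty$-transformation $\mathbf i^{\mathcal A}:\mathrm{id}_{\mathcal A}\to\mathrm{id}_{\mathcal A}$ with $(\mathbf i^{\mathcal A}\otimes\mathbf i^{\mathcal A})B_2\equiv\mathbf i^{\mathcal A}$ and such that the chain maps $({}_X\mathbf i^{\mathcal A}_0\otimes1)b_2$ and $(1\otimes{}_Y\mathbf i^{\mathcal A}_0)b_2:s\mathcal A(X,Y)\to s\mathcal A(X,Y)$ are homotopy invertible for all $X,Y$. An $A_\infty$-functor $f:\mathcal A\to\mathcal B$ between unital $A_\infty$-categories is unital if $f\mathbf i^{\mathcal B}\equiv\mathbf i^{\mathcal A}f$. $A_\infty$-functors $f,g:\mathcal A\to\mathcal B$ to a unital $\mathcal B$ are isomorphic if there are natural $r:f\to g$, $p:g\to f$ with $(r\otimes p)B_2\equiv f\mathbf i^{\mathcal B}$ and $(p\otimes r)B_2\equiv g\mathbf i^{\mathcal B}$. Unital $A_\infty$-categories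 $\mathcal A$, $\mathcal B$ are equivalent in the 2-category $A_\infty^u$ if there are unital $A_\infty$-functors $\phi:\mathcal A\to\mathcal B$, $\psi:\mathcal B\to\mathcal A$ such that $\phi\psi$ (first $\phi$, then $\psi$) is isomorphic to $\mathrm{id}_{\mathcal A}$ and $\psi\phi$ is isomorphic to $\mathrm{id}_{\mathcal B}$. **Proposition.** Let $\mathcal A$ be a unital $A_\infty$-category with unit transformation $\mathbf i^{\mathcal A}$. Then $\mathcal A$ is contractible if and only if any one of the following conditions holds, and these conditions are all equivalent: (C0) $\mathcal A$ is equivalent in $A_\infty^u$ to a unital $A_\infty$-category $\mathcal O$ such that $\mathcal O(U,V)=0$ for all objects $U,V$ of $\mathcal O$; (C1$'$) for all objects $X,Y$ of $\mathcal A$ the complex $(s\mathcal A(X,Y),b_1)$ is contractible; (C2$'$) for any object $X$ of $\mathcal A$ the complex $(s\mathcal A(X,X),b_1)$ is contractible; (C3$'$) for any object $X$ of $\mathcal A$ the complex $(s\mathcal A(X,X),b_1)$ is acyclic; (C4$'$) for any object $X$ of $\mathcal A$ there is an element ${}_Xv\in(s\mathcal A)^{-2}(X,X)$ such that ${}_X\mathbf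 i^{\mathcal A}_0={}_Xv\,b_1$; (C5$'$) $\mathbf i^{\mathcal A}\equiv0:\mathrm{id}_{\mathcal A}\to\mathrm{id}_{\mathcal A}:\mathcal A\to\mathcal A$; (C10$'$) there is an isomorphism of $A_\infty$-functors $\mathrm{id}_{\mathcal A}\simeq\mathcal O^{\mathrm{id}}:\mathcal A\to\mathcal A$, where $X\mathcal O^{\mathrm{id}}=X$ and $\mathcal O^{\mathrm{id}}_k=0$ for all $k\ge1$. -/

import Mathlib

universe w u v

namespace AInf

/-- Finite composable strings `(x₁, …, xₙ)`, `n ≥ 0`, of elements `xᵢ ∈ V X_{i-1} X_i`, with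
`X₀ = X` and `Xₙ = Y`. They stand for the decomposable tensors `x₁ ⊗ ⋯ ⊗ xₙ` of `TⁿV(X, Y)`;
`nil X` stands for the generator `1` of the summand `k` of `T⁰V(X, X)`. -/
inductive Str {S : Type u} (V : S → S → Type v) : S → S → Type (max u v)
  | nil (X : S) : Str V X X
  | cons {X Y Z : S} (x : V X Y) (p : Str V Y Z) : Str V X Z

namespace Str

variable {S : Type u} {V : S → S → Type v}

/-- Concatenation of strings. -/
def append : {X Y Z : S} → Str V X Y → Str V Y Z → Str V X Z
  | _, _, _, nil _, q => q
  | _, _, _, cons x p, q => cons x (append p q)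

/-- The string `(x)` of length one. -/
def single {X Y : S} (x : V X Y) : Str V X Y := cons x (nil Y)

/-- Entrywise application of a map of quivers. -/
def map {S' : Type*} {V' : S' → S' → Type*} (F : S → S')
    (φ : ∀ {X Y : S}, V X Y → V' (F X) (F Y)) : {X Y : S} → Str V X Y → Str V' (F X) (F Y)
  | _, _, nil X => nil (F X)
  | _, _, cons x p => cons (φ x) (map F φ p)

/-- All the ways to cut a string in two (possibly empty) parts: `w = p ++ q`. -/
def cuts : {X Y : S} → Str V X Y → List ((Z : S) × Str V X Z × Str V Z Y)
  | _, _, nil X => [⟨X, nil X, nil X⟩]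
  | X, _, cons x p =>
      ⟨X, nil X, cons x p⟩ :: (cuts p).map fun c => ⟨c.1, cons x c.2.1, c.2.2⟩

/-- All the ways to write a string as a concatenation `w = q₁ ++ ⋯ ++ q_l`, `l ≥ 0`, of nonempty
strings; a decomposition is recorded as the string `(q₁, …, q_l)` of strings. The first entry of
a nonempty string either is a block of its own or is the head of the first block of a
decomposition of the rest. -/
def blocks : {X Y : S} → Str V X Y → List (Str (Str V) X Y)
  | _, _, nil X => [nil X]
  | _, _, cons x p => (blocks p).flatMap fun P =>
      match P with
      | nil _ => [cons (single x) (nil _)]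
      | cons q P' => [cons (single x) (cons q P'), cons (cons x q) P']

end Str

/-- A graded `k`-linear quiver: a `ℤ`-graded `k`-module `Hom X Y` for each pair of objects. -/
structure GradedQuiver (k : Type w) [CommRing k] where
  Obj : Type u
  Hom : Obj → Obj → Type v
  [addCommGroup : ∀ X Y, AddCommGroup (Hom X Y)]
  [module : ∀ X Y, Module k (Hom X Y)]
  /-- `gr X Y d` is the component of degree `d` of `Hom X Y`. -/
  gr : ∀ X Y, ℤ → Submodule k (Hom X Y)
  isInternal : ∀ X Y, DirectSum.IsInternal (gr X Y)

attribute [instance] GradedQuiver.addCommGroup GradedQuiver.module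

variable {k : Type w} [CommRing k]

namespace GradedQuiver

/-- Strings of elements of a graded quiver (decomposable tensors). -/
abbrev Tens (Q : GradedQuiver.{w, u, v} k) (X Y : Q.Obj) : Type (max u v) := Str Q.Hom X Y

/-- The linear map `x ↦ (-1)^{d · deg x} x`: the Koszul sign produced when a map of degree `d`
moves past `x`. -/
noncomputable def twist (Q : GradedQuiver.{w, u, v} k) (d : ℤ) {X Y : Q.Obj} :
    Q.Hom X Y →ₗ[k] Q.Hom X Y :=
  (DirectSum.toModule k ℤ (Q.Hom X Y)
      (fun e => (((d * e).negOnePow : ℤˣ) : ℤ) • (Q.gr X Y e).subtype)) ∘ₗ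
    (LinearEquiv.ofBijective (DirectSum.coeLinearMap (Q.gr X Y)) (Q.isInternal X Y)).symm

theorem twist_of_mem (Q : GradedQuiver.{w, u, v} k) (d e : ℤ) {X Y : Q.Obj} {x : Q.Hom X Y}
    (hx : x ∈ Q.gr X Y e) : Q.twist d x = (((d * e).negOnePow : ℤˣ) : ℤ) • x := by
  have h : (LinearEquiv.ofBijective (DirectSum.coeLinearMap (Q.gr X Y))
      (Q.isInternal X Y)).symm x =
      DirectSum.lof k ℤ (fun e => Q.gr X Y e) e ⟨x, hx⟩ := by
    rw [LinearEquiv.symm_apply_eq]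
    exact (DirectSum.coeLinearMap_lof (Q.gr X Y) e ⟨x, hx⟩).symm
  simp only [twist, LinearMap.comp_apply, LinearEquiv.coe_coe, h, DirectSum.toModule_lof]
  rfl

/-- The Koszul sign applied to every entry of a string: total sign `(-1)^{d (deg x₁ + ⋯)}`. -/
noncomputable def twistStr (Q : GradedQuiver.{w, u, v} k) (d : ℤ) {X Y : Q.Obj}
    (p : Q.Tens X Y) : Q.Tens X Y :=
  p.map id (fun x => Q.twist d x)

/-- All entries of the string are homogeneous, of total degree `d`. -/
def HasDegree (Q : GradedQuiver.{w, u, v} k) : {X Y : Q.Obj} → Q.Tens X Y → ℤ → Prop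
  | _, _, .nil _, d => d = 0
  | _, _, .cons (X := X) (Y := Y) x p, d =>
      ∃ a b : ℤ, x ∈ Q.gr X Y a ∧ HasDegree Q p b ∧ d = a + b

end GradedQuiver

/-- A family of functions on decomposable tensors `x₁ ⊗ ⋯ ⊗ xₙ ∈ TⁿQ(X, Y)`, `n ≥ 0`, with values
in `R(F X, G Y)`. -/
abbrev Components (Q R : GradedQuiver.{w, u, v} k) (F G : Q.Obj → R.Obj) : Type (max u v) :=
  ∀ ⦃X Y : Q.Obj⦄, Q.Tens X Y → R.Hom (F X) (G Y)

/-- The family consists of `k`-multilinear maps, that is, of `k`-linear maps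
`φₙ : TⁿQ(X, Y) → R(F X, G Y)`. -/
def IsMultilinear {Q R : GradedQuiver.{w, u, v} k} {F G : Q.Obj → R.Obj}
    (φ : Components Q R F G) : Prop :=
  ∀ {X A B Y : Q.Obj} (p : Q.Tens X A) (q : Q.Tens B Y),
    IsLinearMap k (fun x : Q.Hom A B => φ (p.append (.cons x q)))

/-- The maps `φₙ : TⁿQ(X, Y) → R(F X, G Y)` have degree `d`. -/
def IsOfDegree {Q R : GradedQuiver.{w, u, v} k} {F G : Q.Obj → R.Obj}
    (φ : Components Q R F G) (d : ℤ) : Prop :=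
  ∀ {X Y : Q.Obj} (p : Q.Tens X Y) (e : ℤ), Q.HasDegree p e → φ p ∈ R.gr (F X) (G Y) (e + d)

/-- The sum of the values of `φ` on a finite sum of decomposable tensors. -/
def sumOver {S : Type u} {V : S → S → Type v} {X Y : S} {M : Type*} [AddCommGroup M]
    (l : List (Str V X Y)) (φ : Str V X Y → M) : M :=
  (l.map φ).sum

/-- The value on `w` of the coderivation of degree `d` with components `b : TⁿQ → Q`: the terms of
`w · ∑ (1^{⊗ r} ⊗ bₙ ⊗ 1^{⊗ t})`. Maps act on the right, so `b` moves past the tail. -/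
noncomputable def derTerms {Q : GradedQuiver.{w, u, v} k}
    (b : ∀ ⦃X Y : Q.Obj⦄, Q.Tens X Y → Q.Hom X Y) (d : ℤ) {X Y : Q.Obj} (z : Q.Tens X Y) : List (Q.Tens X Y) :=
  z.cuts.flatMap fun c => c.2.2.cuts.map fun c' =>
    c.2.1.append (.cons (b c'.2.1) (Q.twistStr d c'.2.2))

/-- An `A_∞`-category `A` over `k`. The underlying graded quiver of this structure is the
suspension `sA`, `(sA)^d(X, Y) = A^{d+1}(X, Y)`, and the operations are
`bₙ : Tⁿ sA(X, Y) → sA(X, Y)`, of degree `1`, with `b₀ = 0` and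
`∑ (1^{⊗ r} ⊗ bₙ ⊗ 1^{⊗ t}) b_{r+1+t} = 0`. -/
structure AInfCat (k : Type w) [CommRing k] extends GradedQuiver.{w, u, v} k where
  b : ∀ ⦃X Y : Obj⦄, toGradedQuiver.Tens X Y → Hom X Y
  b_nil : ∀ X : Obj, b (.nil X) = 0
  b_multilinear : IsMultilinear (R := toGradedQuiver) (F := fun X => X) (G := fun X => X) b
  b_degree : IsOfDegree (R := toGradedQuiver) (F := fun X => X) (G := fun X => X) b 1
  b_b : ∀ {X Y : Obj} (z : toGradedQuiver.Tens X Y),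
    sumOver (derTerms b 1 z) (fun y => b y) = 0

/-- The data of a morphism of quivers `f : Ob A → Ob B`, `fₙ : Tⁿ sA(X, Y) → sB(X f, Y f)`. -/
structure PreFunctor (A B : AInfCat.{w, u, v} k) where
  obj : A.Obj → B.Obj
  comp : Components A.toGradedQuiver B.toGradedQuiver obj obj

namespace PreFunctor

variable {A B C : AInfCat.{w, u, v} k}

/-- The cocategory homomorphism `T sA → T sB` with components `f`: the terms of
`∑ f_{i₁} ⊗ ⋯ ⊗ f_{i_l}`, over all decompositions into nonempty blocks. -/
def terms (f : PreFunctor A B) {X Y : A.Obj} (z : A.Tens X Y) :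
    List (B.Tens (f.obj X) (f.obj Y)) :=
  z.blocks.map fun P => P.map f.obj (fun q => f.comp q)

/-- The identity functor: `id₁ = 1` and `idₙ = 0` for `n ≠ 1`. -/
def ident (A : AInfCat.{w, u, v} k) : PreFunctor A A where
  obj := fun X => X
  comp := fun _ _ z => match z with
    | .cons x (.nil _) => x
    | _ => 0

/-- The composition `fg` (first `f`, then `g`): `(fg)ₙ = ∑ (f_{i₁} ⊗ ⋯ ⊗ f_{i_l}) g_l`. -/
def compose (f : PreFunctor A B) (g : PreFunctor B C) : PreFunctor A C where
  obj := fun X => g.obj (f.obj X)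
  comp := fun _ _ z => sumOver (f.terms z) fun y => g.comp y

/-- The functor `O^f`: the same as `f` on objects, with all components zero. -/
def zeroOf (f : PreFunctor A B) : PreFunctor A B where
  obj := f.obj
  comp := fun _ _ _ => 0

end PreFunctor

/-- `f` is an `A_∞`-functor: its components (`f₀ = 0`) are linear maps of degree `0` and
`∑ (f_{i₁} ⊗ ⋯ ⊗ f_{i_l}) b_l = ∑ (1^{⊗ r} ⊗ bₙ ⊗ 1^{⊗ t}) f_{r+1+t}`. -/
structure IsAInfFunctor {A B : AInfCat.{w, u, v} k} (f : PreFunctor A B) : Prop where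
  nil : ∀ X : A.Obj, f.comp (.nil X) = 0
  multilinear : IsMultilinear f.comp
  degree : IsOfDegree f.comp 0
  comm : ∀ {X Y : A.Obj} (z : A.Tens X Y),
    sumOver (f.terms z) (fun y => B.b y) = sumOver (derTerms A.b 1 z) (fun y => f.comp y)

/-- An `(f, g)`-coderivation of degree `d`, given by its components
`rₙ : Tⁿ sA(X, Y) → sB(X f, Y g)`, `n ≥ 0`. An `A_∞`-transformation `f → g` is an
`(f, g)`-coderivation of degree `-1`. -/
structure Coder {A B : AInfCat.{w, u, v} k} (f g : PreFunctor A B) (d : ℤ) where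
  comp : Components A.toGradedQuiver B.toGradedQuiver f.obj g.obj
  multilinear : IsMultilinear comp
  degree : IsOfDegree comp d

section Transformations

variable {A B C : AInfCat.{w, u, v} k}

/-- The terms of `∑ f_{i₁} ⊗ ⋯ ⊗ f_{i_α} ⊗ r_j ⊗ g_{j₁} ⊗ ⋯ ⊗ g_{j_β}`, the value of the
`(f, g)`-coderivation of degree `d` with components `r`. -/
noncomputable def coderTerms (f g : PreFunctor A B) (d : ℤ)
    (r : Components A.toGradedQuiver B.toGradedQuiver f.obj g.obj) {X Y : A.Obj}
    (z : A.Tens X Y) : List (B.Tens (f.obj X) (g.obj Y)) :=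
  z.cuts.flatMap fun c => c.2.2.cuts.flatMap fun c' =>
    (f.terms c.2.1).flatMap fun P => (g.terms (A.twistStr d c'.2.2)).map fun R =>
      P.append (.cons (r c'.2.1) R)

/-- The terms of `(r ⊗ p)θ = ∑ f ⊗ ⋯ ⊗ f ⊗ r_j ⊗ g ⊗ ⋯ ⊗ g ⊗ p_t ⊗ h ⊗ ⋯ ⊗ h`, for
`r : f → g` of degree `d` and `p : g → h` of degree `d'`. -/
noncomputable def thetaTerms (f g h : PreFunctor A B) (d d' : ℤ)
    (r : Components A.toGradedQuiver B.toGradedQuiver f.obj g.obj)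
    (p : Components A.toGradedQuiver B.toGradedQuiver g.obj h.obj) {X Y : A.Obj}
    (z : A.Tens X Y) : List (B.Tens (f.obj X) (h.obj Y)) :=
  z.cuts.flatMap fun c => c.2.2.cuts.flatMap fun c' =>
    (f.terms c.2.1).flatMap fun P =>
      (coderTerms g h d' p (A.twistStr d c'.2.2)).map fun R =>
        P.append (.cons (r c'.2.1) R)

/-- The components of `r B₁ = r b - (-1)^d b r`. -/
noncomputable def B₁ {f g : PreFunctor A B} {d : ℤ} (r : Coder f g d) :
    Components A.toGradedQuiver B.toGradedQuiver f.obj g.obj :=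
  fun _ _ z => sumOver (coderTerms f g d r.comp z) (fun y => B.b y) -
    ((d.negOnePow : ℤˣ) : ℤ) • sumOver (derTerms A.b 1 z) (fun y => r.comp y)

/-- The components of `(r ⊗ p) B₂ = (r ⊗ p)θ b`, the vertical composition of
`A_∞`-transformations. -/
noncomputable def B₂ {f g h : PreFunctor A B} {d d' : ℤ} (r : Coder f g d) (p : Coder g h d') :
    Components A.toGradedQuiver B.toGradedQuiver f.obj h.obj :=
  fun _ _ z => sumOver (thetaTerms f g h d d' r.comp p.comp z) (fun y => B.b y)

/-- An `A_∞`-transformation `r` is natural if `r B₁ = 0`. -/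
def IsNatural {f g : PreFunctor A B} (r : Coder f g (-1)) : Prop :=
  ∀ {X Y : A.Obj} (z : A.Tens X Y), B₁ r z = 0

/-- Equivalence `r ≡ p : f → g` of (natural) `A_∞`-transformations, given by their components:
`r - p = v B₁` for some `(f, g)`-coderivation `v` of degree `-2`. -/
def Equivalent (f g : PreFunctor A B)
    (r p : Components A.toGradedQuiver B.toGradedQuiver f.obj g.obj) : Prop :=
  ∃ v : Coder f g (-2), ∀ {X Y : A.Obj} (z : A.Tens X Y), r z - p z = B₁ v z

/-- The components of `f r : fg → fh` for `f : A → B` and `r : g → h : B → C`. -/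
def whiskerLeft (f : PreFunctor A B) {g h : PreFunctor B C} {d : ℤ} (r : Coder g h d) :
    Components A.toGradedQuiver C.toGradedQuiver (f.compose g).obj (f.compose h).obj :=
  fun _ _ z => sumOver (f.terms z) (fun y => r.comp y)

/-- The components of `r h : fh → gh` for `r : f → g : A → B` and `h : B → C`. -/
noncomputable def whiskerRight {f g : PreFunctor A B} {d : ℤ} (r : Coder f g d)
    (h : PreFunctor B C) :
    Components A.toGradedQuiver C.toGradedQuiver (f.compose h).obj (g.compose h).obj :=
  fun _ _ z => sumOver (coderTerms f g d r.comp z) (fun y => h.comp y)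

end Transformations

namespace AInfCat

variable (A : AInfCat.{w, u, v} k)

/-- The differential `b₁` of the complex `(sA(X, Y), b₁)`. -/
def b₁ {X Y : A.Obj} (x : A.Hom X Y) : A.Hom X Y := A.b (.single x)

/-- The operation `b₂` on a decomposable tensor `x ⊗ y`. -/
def b₂ {X Y Z : A.Obj} (x : A.Hom X Y) (y : A.Hom Y Z) : A.Hom X Z := A.b (.cons x (.single y))

variable {A}

/-- A `k`-linear map `sA(X, Y) → sA(X, Y)` has degree `d`. -/
def MapOfDegree {X Y : A.Obj} (h : A.Hom X Y →ₗ[k] A.Hom X Y) (d : ℤ) : Prop :=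
  ∀ (e : ℤ) (x : A.Hom X Y), x ∈ A.gr X Y e → h x ∈ A.gr X Y (e + d)

/-- Maps `φ, ψ` of the complex `(sA(X, Y), b₁)` to itself are homotopic. -/
def Homotopic {X Y : A.Obj} (φ ψ : A.Hom X Y → A.Hom X Y) : Prop :=
  ∃ h : A.Hom X Y →ₗ[k] A.Hom X Y, MapOfDegree h (-1) ∧
    ∀ x, φ x - ψ x = A.b₁ (h x) + h (A.b₁ x)

/-- A chain map `φ` of the complex `(sA(X, Y), b₁)` to itself is homotopy invertible. -/
def HomotopyInvertible {X Y : A.Obj} (φ : A.Hom X Y → A.Hom X Y) : Prop :=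
  ∃ ψ : A.Hom X Y →ₗ[k] A.Hom X Y, MapOfDegree ψ 0 ∧ (∀ x, ψ (A.b₁ x) = A.b₁ (ψ x)) ∧
    Homotopic (fun x => ψ (φ x)) (fun x => x) ∧ Homotopic (fun x => φ (ψ x)) (fun x => x)

variable (A)

/-- The complex `(sA(X, Y), b₁)` is contractible: its identity map is homotopic to zero. -/
def ContractibleHom (X Y : A.Obj) : Prop :=
  Homotopic (fun x : A.Hom X Y => x) (fun _ => 0)

/-- The complex `(sA(X, Y), b₁)` is acyclic: every cycle is a boundary. -/
def AcyclicHom (X Y : A.Obj) : Prop :=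
  ∀ x : A.Hom X Y, A.b₁ x = 0 → ∃ y : A.Hom X Y, A.b₁ y = x

/-- An `A_∞`-category is contractible if all complexes `(sA(X, Y), b₁)` are contractible. -/
def IsContractible : Prop := ∀ X Y : A.Obj, A.ContractibleHom X Y

/-- A unit transformation `i : id → id : A → A`: a natural `A_∞`-transformation with
`(i ⊗ i)B₂ ≡ i`, such that the chain maps `(i₀ ⊗ 1)b₂` and `(1 ⊗ i₀)b₂` of `(sA(X, Y), b₁)` are
homotopy invertible. An `A_∞`-category is unital if it has a unit transformation. -/
structure UnitTransformation extends
    Coder (PreFunctor.ident A) (PreFunctor.ident A) (-1) where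
  natural : IsNatural toCoder
  idempotent : Equivalent (PreFunctor.ident A) (PreFunctor.ident A)
    (B₂ toCoder toCoder) toCoder.comp
  left_invertible : ∀ X Y : A.Obj,
    HomotopyInvertible fun x : A.Hom X Y => A.b₂ (comp (.nil X)) (A.twist (-1) x)
  right_invertible : ∀ X Y : A.Obj,
    HomotopyInvertible fun x : A.Hom X Y => A.b₂ x (comp (.nil Y))

end AInfCat

section Unital

variable {A B : AInfCat.{w, u, v} k}

/-- `f` is a unital `A_∞`-functor between unital `A_∞`-categories: `f i^B ≡ i^A f`. -/
structure IsUnitalFunctor (iA : A.UnitTransformation) (iB : B.UnitTransformation)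
    (f : PreFunctor A B) : Prop where
  isAInfFunctor : IsAInfFunctor f
  unital : Equivalent f f (whiskerLeft f iB.toCoder) (whiskerRight iA.toCoder f)

/-- `f, g : A → B` are isomorphic, where `B` is unital: there are natural `A_∞`-transformations
`r : f → g` and `p : g → f` with `(r ⊗ p)B₂ ≡ f i^B` and `(p ⊗ r)B₂ ≡ g i^B`. -/
def Isomorphic (iB : B.UnitTransformation) (f g : PreFunctor A B) : Prop :=
  ∃ (r : Coder f g (-1)) (p : Coder g f (-1)), IsNatural r ∧ IsNatural p ∧
    Equivalent f f (B₂ r p) (whiskerLeft f iB.toCoder) ∧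
    Equivalent g g (B₂ p r) (whiskerLeft g iB.toCoder)

/-- `A` and `B` are equivalent objects of the 2-category `A_∞^u` of unital `A_∞`-categories,
unital `A_∞`-functors, and equivalence classes of natural `A_∞`-transformations. -/
def EquivalentUnital (iA : A.UnitTransformation) (iB : B.UnitTransformation) : Prop :=
  ∃ (φ : PreFunctor A B) (ψ : PreFunctor B A),
    IsUnitalFunctor iA iB φ ∧ IsUnitalFunctor iB iA ψ ∧
    Isomorphic iA (φ.compose ψ) (PreFunctor.ident A) ∧
    Isomorphic iB (ψ.compose φ) (PreFunctor.ident B)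

end Unital

end AInf

/-! Everything turns on the statement that each unit element `i.comp (.nil X)` is a `b₁`-boundary.
If it is `b₁ x`, then multiplication by it on `sA(X, Y)` is null-homotopic through `b₂ x`; being
also homotopy invertible, it forces the identity of `sA(X, Y)` to be null-homotopic for every `Y`
(`UnitTransformation.contractibleHom`). Conversely the unit element is a cycle, so acyclicity of
`sA(X, X)` makes it a boundary, and the degree `-2` part of a primitive suffices
(`exists_homogeneous_b₁_eq`).

The conditions on transformations give this statement back by evaluation on short strings. If `i ≡
0`, the empty string is enough. For an isomorphism `r`, `p` between the identity and its zero
version, naturality of `r` on strings of length one makes `b₂(p₀, r₀)` a boundary, and it is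
homologous to the unit. For an equivalence with a category without nonzero morphisms, unitality of
`ψ` makes the unit at `ψφX` a boundary; hence `r₀ : ψφX → X` is a boundary, and so is `b₂(p₀, r₀)`.

The substantial direction is from contractibility to `i ≡ 0` (`IsContractible.exists_bracket_eq`).
The commutator with `b` squares to zero on coderivations (`bracket_bracket`), and the contracting
homotopies of the complexes `sA(X, Y)` allow a cycle to be integrated one string length at a time.
Once the units are equivalent to zero, zero transformations serve as mutually inverse isomorphisms,
which yields the remaining two conditions. -/

namespace AInf

/-! ### Strings and sums over their cuts. -/

namespace Str

variable {S : Type u} {V : S → S → Type v}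

/-- The number of entries of a string. -/
def length : {X Y : S} → Str V X Y → ℕ
  | _, _, nil _ => 0
  | _, _, cons _ p => length p + 1

@[simp] theorem length_nil (X : S) : (nil X : Str V X X).length = 0 := rfl

@[simp] theorem length_cons {X Y Z : S} (x : V X Y) (p : Str V Y Z) :
    (cons x p).length = p.length + 1 := rfl

@[simp] theorem nil_append {X Y : S} (p : Str V X Y) : (nil X).append p = p := rfl

@[simp] theorem cons_append {X Y Z W : S} (x : V X Y) (p : Str V Y Z) (q : Str V Z W) :
    (cons x p).append q = cons x (p.append q) := rfl

theorem append_assoc {X Y Z W : S} (p : Str V X Y) (q : Str V Y Z) (r : Str V Z W) :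
    (p.append q).append r = p.append (q.append r) := by
  induction p with
  | nil => rfl
  | cons x p ih => simp [ih]

@[simp] theorem length_append {X Y Z : S} (p : Str V X Y) (q : Str V Y Z) :
    (p.append q).length = p.length + q.length := by
  induction p with
  | nil => simp
  | cons x p ih => simp [ih]; omega

/-- The sum of the values of `F` on all the ways to cut a string in two parts. -/
def cutSum {M : Type*} [AddCommMonoid M] {X Y : S} (z : Str V X Y)
    (F : ∀ Z, Str V X Z → Str V Z Y → M) : M :=
  (z.cuts.map fun c => F c.1 c.2.1 c.2.2).sum

section

variable {M : Type*} [AddCommMonoid M]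

@[simp] theorem cutSum_nil (X : S) (F : ∀ Z, Str V X Z → Str V Z X → M) :
    (nil X).cutSum F = F X (nil X) (nil X) := by
  simp [cutSum, cuts]

@[simp] theorem cutSum_cons {X Y Z : S} (x : V X Y) (p : Str V Y Z)
    (F : ∀ W, Str V X W → Str V W Z → M) :
    (cons x p).cutSum F = F X (nil X) (cons x p) + p.cutSum fun W a t => F W (cons x a) t := by
  simp [cutSum, cuts, Function.comp_def]

theorem cutSum_congr {X Y : S} (z : Str V X Y) {F G : ∀ Z, Str V X Z → Str V Z Y → M}
    (h : ∀ Z (a : Str V X Z) (t : Str V Z Y), a.length + t.length = z.length →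
      F Z a t = G Z a t) : z.cutSum F = z.cutSum G := by
  induction z with
  | nil X => simpa using h _ _ _ rfl
  | cons x p ih =>
    rw [cutSum_cons, cutSum_cons, h _ _ _ (by simp)]
    congr 1
    refine ih fun Z a t hat => h _ _ _ ?_
    simp; omega

@[simp] theorem cutSum_add {X Y : S} (z : Str V X Y) (F G : ∀ Z, Str V X Z → Str V Z Y → M) :
    (z.cutSum fun Z a t => F Z a t + G Z a t) = z.cutSum F + z.cutSum G :=
  List.sum_map_add

theorem map_cutSum {N : Type*} [AddCommMonoid N] (g : M →+ N) {X Y : S} (z : Str V X Y)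
    (F : ∀ Z, Str V X Z → Str V Z Y → M) :
    g (z.cutSum F) = z.cutSum fun Z a t => g (F Z a t) := by
  simp [cutSum, map_list_sum, Function.comp_def]

@[simp] theorem cutSum_zero {X Y : S} (z : Str V X Y) :
    (z.cutSum fun _ _ _ => (0 : M)) = 0 := by
  simp [cutSum]

/-- A sum over cuts in which only the cut with empty right part contributes. -/
theorem cutSum_eq_last {X Y : S} (z : Str V X Y) (F : ∀ Z, Str V X Z → Str V Z Y → M)
    (h : ∀ Z (a : Str V X Z) (t : Str V Z Y), a.length < z.length → F Z a t = 0) :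
    z.cutSum F = F Y z (nil Y) := by
  induction z with
  | nil X => simp
  | cons x p ih =>
    rw [cutSum_cons, h _ _ _ (by simp), zero_add]
    exact ih _ fun Z a t hat => h _ _ _ (by simp; omega)

end

end Str

/-! ### Multilinear functions on strings and Koszul signs. -/

variable {k : Type w} [CommRing k] {Q : GradedQuiver.{w, u, v} k}

/-- A function on the decomposable tensors in `TⁿQ(X, Y)`, `n ≥ 0`, that is linear in each
entry. -/
def MultilinearOn {X Y : Q.Obj} {M : Type*} [AddCommGroup M] [Module k M]
    (φ : Q.Tens X Y → M) : Prop :=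
  ∀ ⦃A B : Q.Obj⦄ (p : Q.Tens X A) (q : Q.Tens B Y),
    IsLinearMap k fun x : Q.Hom A B => φ (p.append (.cons x q))

namespace MultilinearOn

variable {M : Type*} [AddCommGroup M] [Module k M] {X Y Z : Q.Obj}

theorem cons {φ : Q.Tens X Z → M} (h : MultilinearOn φ) (x : Q.Hom X Y) :
    MultilinearOn fun p : Q.Tens Y Z => φ (.cons x p) :=
  fun _ _ p q => h (.cons x p) q

theorem append_left {φ : Q.Tens X Z → M} (h : MultilinearOn φ) (a : Q.Tens X Y) :
    MultilinearOn fun p : Q.Tens Y Z => φ (a.append p) := by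
  intro A B p q
  simpa only [Str.append_assoc] using h (a.append p) q

theorem head {φ : Q.Tens X Z → M} (h : MultilinearOn φ) (p : Q.Tens Y Z) :
    IsLinearMap k fun x : Q.Hom X Y => φ (.cons x p) :=
  h (.nil X) p

theorem map_zero {φ : Q.Tens X Y → M} (h : MultilinearOn φ) {A B : Q.Obj} (p : Q.Tens X A)
    (q : Q.Tens B Y) : φ (p.append (.cons 0 q)) = 0 :=
  (h p q).map_zero

theorem head_zero {φ : Q.Tens X Z → M} (h : MultilinearOn φ) (p : Q.Tens Y Z) :
    φ (.cons 0 p) = 0 :=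
  (h.head p).map_zero

theorem head_zsmul {φ : Q.Tens X Z → M} (h : MultilinearOn φ) (n : ℤ) (x : Q.Hom X Y)
    (p : Q.Tens Y Z) : φ (.cons (n • x) p) = n • φ (.cons x p) :=
  map_zsmul (IsLinearMap.mk' _ (h.head p)) n x

theorem add {φ ψ : Q.Tens X Y → M} (hφ : MultilinearOn φ) (hψ : MultilinearOn ψ) :
    MultilinearOn fun z => φ z + ψ z :=
  fun _ _ p q => (IsLinearMap.mk' _ (hφ p q) + IsLinearMap.mk' _ (hψ p q)).isLinear

theorem sub {φ ψ : Q.Tens X Y → M} (hφ : MultilinearOn φ) (hψ : MultilinearOn ψ) :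
    MultilinearOn fun z => φ z - ψ z :=
  fun _ _ p q => (IsLinearMap.mk' _ (hφ p q) - IsLinearMap.mk' _ (hψ p q)).isLinear

theorem comp_linear {N : Type*} [AddCommGroup N] [Module k N] (g : M →ₗ[k] N)
    {φ : Q.Tens X Y → M} (hφ : MultilinearOn φ) : MultilinearOn fun z => g (φ z) :=
  fun _ _ p q => (g ∘ₗ IsLinearMap.mk' _ (hφ p q)).isLinear

theorem zsmul (n : ℤ) {φ : Q.Tens X Y → M} (hφ : MultilinearOn φ) :
    MultilinearOn fun z => n • φ z :=
  fun _ _ p q => (n • IsLinearMap.mk' _ (hφ p q)).isLinear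

theorem twistStr {φ : Q.Tens X Y → M} (hφ : MultilinearOn φ) (d : ℤ) :
    MultilinearOn fun z => φ (Q.twistStr d z) := by
  have key : ∀ {A B C : Q.Obj} (p : Q.Tens A B) (q : Q.Tens B C),
      Q.twistStr d (p.append q) = (Q.twistStr d p).append (Q.twistStr d q) := by
    intro A B C p q
    induction p with
    | nil => rfl
    | cons x p ih => exact congrArg (Str.cons (Q.twist d x)) (ih q)
  intro A B p q
  simp only [key]
  exact (IsLinearMap.mk' _ (hφ (Q.twistStr d p) (Q.twistStr d q)) ∘ₗ Q.twist d).isLinear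

/-- Each cut leaves a given entry on exactly one side, so linearity in that entry only has to be
known with the other side fixed. -/
theorem cutSum {F : ∀ Z, Q.Tens X Z → Q.Tens Z Y → M}
    (hl : ∀ Z (t : Q.Tens Z Y), MultilinearOn fun a => F Z a t)
    (hr : ∀ Z (a : Q.Tens X Z), MultilinearOn fun t => F Z a t) :
    MultilinearOn fun z : Q.Tens X Y => z.cutSum F := by
  have sum_lin : ∀ {A B C D : Q.Obj} (z : Q.Tens A B)
      (G : ∀ Z, Q.Hom C D → Q.Tens A Z → Q.Tens Z B → M),
      (∀ Z a t, IsLinearMap k fun x => G Z x a t) →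
      IsLinearMap k fun x => z.cutSum fun Z a t => G Z x a t := by
    intro A B C D z G hG
    constructor
    · intro x y
      simp only [(hG _ _ _).map_add, Str.cutSum_add]
    · intro c x
      simp only [(hG _ _ _).map_smul]
      exact (Str.map_cutSum (DistribSMul.toAddMonoidHom M c) z _).symm
  intro A B p q
  induction p with
  | nil X =>
    simp only [Str.nil_append, Str.cutSum_cons]
    exact (IsLinearMap.mk' _ (hr X (.nil X) (.nil X) q) +
      IsLinearMap.mk' _ (sum_lin q _ fun Z a t => hl Z t (.nil X) a)).isLinear
  | cons y p ih =>
    simp only [Str.cons_append, Str.cutSum_cons]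
    exact (IsLinearMap.mk' _ (hr _ (.nil _) (.cons y p) q) +
      IsLinearMap.mk' _ (ih (F := fun Z a t => F Z (.cons y a) t)
        (fun Z t => (hl Z t).cons y) fun Z a => hr Z (.cons y a))).isLinear

/-- Two multilinear functions that agree on strings of homogeneous elements are equal. -/
theorem ext_homogeneous {φ ψ : Q.Tens X Y → M} (hφ : MultilinearOn φ) (hψ : MultilinearOn ψ)
    (h : ∀ z d, Q.HasDegree z d → φ z = ψ z) (z : Q.Tens X Y) : φ z = ψ z := by
  induction z with
  | nil => exact h _ 0 rfl
  | @cons X Y Z x p ih =>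
    have hx : x ∈ ⨆ e, Q.gr X Y e := by
      rw [(Q.isInternal X Y).submodule_iSup_eq_top]; trivial
    refine Submodule.iSup_induction (Q.gr X Y)
      (motive := fun x => φ (.cons x p) = ψ (.cons x p)) hx ?_ ?_ ?_
    · intro e x hx
      exact ih (hφ.cons x) (hψ.cons x) fun z d hz => h _ (e + d) ⟨e, d, hx, hz, rfl⟩
    · rw [hφ.head_zero, hψ.head_zero]
    · intro x y hx hy
      rw [(hφ.head p).map_add, (hψ.head p).map_add, hx, hy]

end MultilinearOn

namespace GradedQuiver

@[simp] theorem twistStr_nil (d : ℤ) (X : Q.Obj) :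
    Q.twistStr d (.nil X) = .nil X := rfl

@[simp] theorem twistStr_cons (d : ℤ) {X Y Z : Q.Obj} (x : Q.Hom X Y) (p : Q.Tens Y Z) :
    Q.twistStr d (.cons x p) = .cons (Q.twist d x) (Q.twistStr d p) := rfl

@[simp] theorem length_twistStr (d : ℤ) {X Y : Q.Obj} (p : Q.Tens X Y) :
    (Q.twistStr d p).length = p.length := by
  induction p with
  | nil => rfl
  | cons x p ih => simp [ih]

theorem twist_twist (d e : ℤ) {X Y : Q.Obj} (x : Q.Hom X Y) :
    Q.twist d (Q.twist e x) = Q.twist (d + e) x := by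
  have hx : x ∈ ⨆ e, Q.gr X Y e := by
    rw [(Q.isInternal X Y).submodule_iSup_eq_top]; trivial
  refine Submodule.iSup_induction (Q.gr X Y)
      (motive := fun x => Q.twist d (Q.twist e x) = Q.twist (d + e) x) hx ?_ ?_ ?_
  · intro c x hx
    rw [Q.twist_of_mem e c hx, map_zsmul, Q.twist_of_mem d c hx, Q.twist_of_mem _ c hx, smul_smul,
      add_mul, Int.negOnePow_add, Units.val_mul, mul_comm]
  · simp
  · intro x y hx hy
    simp [hx, hy]

theorem twistStr_twistStr (d e : ℤ) {X Y : Q.Obj} (p : Q.Tens X Y) :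
    Q.twistStr d (Q.twistStr e p) = Q.twistStr (d + e) p := by
  induction p with
  | nil => rfl
  | cons x p ih => simp [ih, twist_twist]

theorem HasDegree.twistStr {X Y : Q.Obj} {p : Q.Tens X Y} {d : ℤ} (h : Q.HasDegree p d) (e : ℤ) :
    Q.HasDegree (Q.twistStr e p) d := by
  induction p generalizing d with
  | nil => exact h
  | cons x p ih =>
    obtain ⟨a, b, hx, hp, rfl⟩ := h
    refine ⟨a, b, ?_, ih hp, rfl⟩
    change Q.twist e x ∈ _
    rw [Q.twist_of_mem e a hx]
    exact zsmul_mem hx _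

theorem HasDegree.append {X Y Z : Q.Obj} {p : Q.Tens X Y} {q : Q.Tens Y Z} {d e : ℤ}
    (hp : Q.HasDegree p d) (hq : Q.HasDegree q e) : Q.HasDegree (p.append q) (d + e) := by
  induction p generalizing d with
  | nil => obtain rfl : d = 0 := hp; simpa using hq
  | cons x p ih =>
    obtain ⟨a, b, hx, hp, rfl⟩ := hp
    exact ⟨a, b + e, hx, ih hp hq, by ring⟩

end GradedQuiver

theorem MultilinearOn.twistStr_of_hasDegree {M : Type*} [AddCommGroup M] [Module k M]
    {X Y : Q.Obj} {φ : Q.Tens X Y → M} (hφ : MultilinearOn φ) (e : ℤ) {p : Q.Tens X Y} {d : ℤ}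
    (hp : Q.HasDegree p d) :
    φ (Q.twistStr e p) = (((e * d).negOnePow : ℤˣ) : ℤ) • φ p := by
  induction p generalizing d with
  | nil => obtain rfl : d = 0 := hp; simp
  | cons x p ih =>
    obtain ⟨a, b, hx, hp, rfl⟩ := hp
    rw [Q.twistStr_cons, Q.twist_of_mem e a hx, hφ.head_zsmul, ih (hφ.cons x) hp, smul_smul,
      mul_add, Int.negOnePow_add, Units.val_mul]

/-- A family of multilinear operations of degree `d` commutes with twisting up to the Koszul
sign. -/
theorem twist_apply {r : ∀ ⦃X Y : Q.Obj⦄, Q.Tens X Y → Q.Hom X Y} {d : ℤ}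
    (hr : ∀ X Y : Q.Obj, MultilinearOn (@r X Y))
    (hd : IsOfDegree (R := Q) (F := fun X => X) (G := fun X => X) r d) (e : ℤ) {X Y : Q.Obj}
    (p : Q.Tens X Y) :
    Q.twist e (r p) = (((e * d).negOnePow : ℤˣ) : ℤ) • r (Q.twistStr e p) := by
  refine MultilinearOn.ext_homogeneous (φ := fun p => Q.twist e (r p)) ((hr X Y).comp_linear _)
    (((hr X Y).twistStr e).zsmul _) (fun z c hz => ?_) p
  rw [Q.twist_of_mem e (c + d) (hd z c hz), (hr _ _).twistStr_of_hasDegree e hz, smul_smul, mul_add,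
    Int.negOnePow_add, Units.val_mul, mul_comm]

end AInf

/-! ### Coderivations along the identity and their composition. -/

namespace AInf

variable {k : Type w} [CommRing k] {Q : GradedQuiver.{w, u, v} k}

theorem GradedQuiver.cutSum_twistStr {M : Type*} [AddCommMonoid M] (e : ℤ) {X Y : Q.Obj}
    (t : Q.Tens X Y) (F : ∀ Z, Q.Tens X Z → Q.Tens Z Y → M) :
    (Q.twistStr e t).cutSum F =
      t.cutSum fun Z a t => F Z (Q.twistStr e a) (Q.twistStr e t) := by
  induction t with
  | nil => simp
  | cons x p ih => simp [ih]

theorem Str.cutSum_zsmul {M : Type*} [AddCommGroup M] {S : Type*} {V : S → S → Type*} {X Y : S}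
    (t : Str V X Y) (n : ℤ) (F : ∀ Z, Str V X Z → Str V Z Y → M) :
    (t.cutSum fun Z a b => n • F Z a b) = n • t.cutSum F :=
  (Str.map_cutSum (zsmulAddGroupHom n) t F).symm

/-- The terms of a coderivation in which its component is applied to an initial segment. -/
noncomputable def headSum {M : Type*} [AddCommGroup M]
    (r : ∀ ⦃X Y : Q.Obj⦄, Q.Tens X Y → Q.Hom X Y) (d : ℤ) {X Y : Q.Obj} (z : Q.Tens X Y)
    (φ : Q.Tens X Y → M) : M :=
  z.cutSum fun _ a t => φ (.cons (r a) (Q.twistStr d t))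

section

variable {M : Type*} [AddCommGroup M]

theorem sumOver_derTerms_nil (r : ∀ ⦃X Y : Q.Obj⦄, Q.Tens X Y → Q.Hom X Y) (d : ℤ) (X : Q.Obj)
    (φ : Q.Tens X X → M) :
    sumOver (derTerms r d (.nil X)) φ = φ (.single (r (.nil X))) := by
  simp [sumOver, derTerms, Str.cuts, Str.single]

theorem sumOver_derTerms_cons (r : ∀ ⦃X Y : Q.Obj⦄, Q.Tens X Y → Q.Hom X Y) (d : ℤ)
    {X Y Z : Q.Obj} (x : Q.Hom X Y) (p : Q.Tens Y Z) (φ : Q.Tens X Z → M) :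
    sumOver (derTerms r d (.cons x p)) φ =
      headSum r d (.cons x p) φ + sumOver (derTerms r d p) fun q => φ (.cons x q) := by
  simp only [sumOver, derTerms, headSum, Str.cutSum, Str.cuts, List.flatMap_cons, List.map_append,
    List.sum_append, List.map_map, Function.comp_def, List.map_flatMap, List.flatMap_map,
    Str.nil_append, Str.cons_append, List.map_cons, List.sum_cons]

theorem sumOver_derTerms_eq_cutSum (r : ∀ ⦃X Y : Q.Obj⦄, Q.Tens X Y → Q.Hom X Y) (d : ℤ)
    {X Y : Q.Obj} (z : Q.Tens X Y) (φ : Q.Tens X Y → M) :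
    sumOver (derTerms r d z) φ =
      z.cutSum fun _ p q => headSum r d q fun q' => φ (p.append q') := by
  simp only [sumOver, derTerms, headSum, Str.cutSum, List.flatMap_def,
    List.map_flatten, List.sum_flatten, List.map_map, Function.comp_def]

theorem sumOver_add {S : Type*} {V : S → S → Type*} {X Y : S} (l : List (Str V X Y))
    (φ ψ : Str V X Y → M) : (sumOver l fun z => φ z + ψ z) = sumOver l φ + sumOver l ψ :=
  List.sum_map_add

theorem map_sumOver {N : Type*} [AddCommGroup N] (g : M →+ N) {S : Type*} {V : S → S → Type*}
    {X Y : S} (l : List (Str V X Y)) (φ : Str V X Y → M) :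
    g (sumOver l φ) = sumOver l fun z => g (φ z) := by
  simp [sumOver, map_list_sum, Function.comp_def]

theorem sumOver_zero {S : Type*} {V : S → S → Type*} {X Y : S} (l : List (Str V X Y)) :
    (sumOver l fun _ => (0 : M)) = 0 := by
  simp [sumOver]

theorem sumOver_zsmul {S : Type*} {V : S → S → Type*} {X Y : S} (l : List (Str V X Y)) (n : ℤ)
    (φ : Str V X Y → M) : (sumOver l fun z => n • φ z) = n • sumOver l φ :=
  (map_sumOver (zsmulAddGroupHom n) l φ).symm

theorem sumOver_sub {S : Type*} {V : S → S → Type*} {X Y : S} (l : List (Str V X Y))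
    (φ ψ : Str V X Y → M) : (sumOver l fun z => φ z - ψ z) = sumOver l φ - sumOver l ψ := by
  simp only [sub_eq_add_neg, ← neg_one_zsmul (ψ _), sumOver_add, sumOver_zsmul]
  simp

end

section

variable {M : Type*} [AddCommGroup M] [Module k M]

theorem MultilinearOn.head_sumOver {X Y Z : Q.Obj} {φ : Q.Tens X Z → M} (h : MultilinearOn φ)
    {S : Type*} {V : S → S → Type*} {A B : S} (l : List (Str V A B)) (F : Str V A B → Q.Hom X Y)
    (p : Q.Tens Y Z) : φ (.cons (sumOver l F) p) = sumOver l fun z => φ (.cons (F z) p) :=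
  map_sumOver (IsLinearMap.mk' _ (h.head p)).toAddMonoidHom l F

variable {r s : ∀ ⦃X Y : Q.Obj⦄, Q.Tens X Y → Q.Hom X Y}

theorem MultilinearOn.headSum (hr : ∀ X Y : Q.Obj, MultilinearOn (@r X Y)) (d : ℤ)
    {X Y : Q.Obj} {φ : Q.Tens X Y → M} (hφ : MultilinearOn φ) :
    MultilinearOn fun z => headSum r d z φ := by
  refine MultilinearOn.cutSum (fun Z t A B p q => ?_) fun Z a => ?_
  · exact (IsLinearMap.mk' _ (hφ.head (Q.twistStr d t)) ∘ₗ IsLinearMap.mk' _ (hr _ _ p q)).isLinear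
  · exact (hφ.cons (r a)).twistStr d

theorem MultilinearOn.sumOver_derTerms (hr : ∀ X Y : Q.Obj, MultilinearOn (@r X Y)) (d : ℤ)
    {X Y : Q.Obj} {φ : Q.Tens X Y → M} (hφ : MultilinearOn φ) :
    MultilinearOn fun z => sumOver (derTerms r d z) φ := by
  simp only [sumOver_derTerms_eq_cutSum]
  refine MultilinearOn.cutSum (fun Z t A B p q => ?_) fun Z a =>
    MultilinearOn.headSum hr d (hφ.append_left a)
  simp only [AInf.headSum, Str.append_assoc, Str.cons_append]
  constructor
  · intro x y
    simp only [(hφ _ _).map_add, Str.cutSum_add]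
  · intro c x
    simp only [(hφ _ _).map_smul]
    exact (Str.map_cutSum (DistribSMul.toAddMonoidHom M c) t _).symm

omit [Module k M] in
/-- A coderivation acts on the two parts of a cut, with the Koszul sign. -/
theorem sumOver_derTerms_cutSum (d : ℤ) {X Y : Q.Obj} (z : Q.Tens X Y)
    (G : ∀ Z, Q.Tens X Z → Q.Tens Z Y → M) :
    sumOver (derTerms r d z) (fun y => y.cutSum G) =
      (z.cutSum fun Z a t => sumOver (derTerms r d a) fun a' => G Z a' (Q.twistStr d t)) +
      z.cutSum fun Z a t => sumOver (derTerms r d t) (G Z a) := by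
  -- Both sides run over the ways to cut `t` into three parts.
  have coassoc : ∀ {A B : Q.Obj} (t : Q.Tens A B)
      (F : ∀ Z W, Q.Tens A Z → Q.Tens Z W → Q.Tens W B → M),
      (t.cutSum fun Z a q => q.cutSum fun W b c => F Z W a b c) =
        t.cutSum fun W p c => p.cutSum fun Z a b => F Z W a b c := by
    intro A B t F
    induction t with
    | nil => simp
    | cons x p ih => simp [ih, add_assoc]
  -- A cut of a string with head `r a` lies either before that head, or after it; in the second case
  -- it comes from a cut of the original string to the right of `a`.
  have headSum_cut : ∀ {A B : Q.Obj} (z : Q.Tens A B) (G : ∀ Z, Q.Tens A Z → Q.Tens Z B → M),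
      headSum r d z (fun y => y.cutSum G) = headSum r d z (G A (.nil A)) +
        z.cutSum fun Z a t => headSum r d a fun a' => G Z a' (Q.twistStr d t) := by
    intro A B z G
    simp only [headSum, Str.cutSum_cons, Str.cutSum_add, GradedQuiver.cutSum_twistStr]
    congr 1
    exact coassoc z fun Z W a b c => G W (.cons (r a) (Q.twistStr d b)) (Q.twistStr d c)
  induction z with
  | nil X =>
    simp only [sumOver_derTerms_nil, Str.single, Str.cutSum_cons, Str.cutSum_nil,
      GradedQuiver.twistStr_nil]
    rw [add_comm]
  | cons x p ih =>
    simp only [sumOver_derTerms_cons, headSum_cut, Str.cutSum_cons, sumOver_add, ih,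
      sumOver_derTerms_nil, Str.cutSum_add]
    simp only [headSum, Str.cutSum_nil, Str.single, GradedQuiver.twistStr_nil]
    abel

/-- Twisting a coderivation. -/
theorem sumOver_derTerms_twistStr (hr : ∀ X Y : Q.Obj, MultilinearOn (@r X Y)) {d : ℤ}
    (hd : IsOfDegree (R := Q) (F := fun X => X) (G := fun X => X) r d) (e : ℤ) {X Y : Q.Obj}
    {φ : Q.Tens X Y → M} (hφ : MultilinearOn φ) (z : Q.Tens X Y) :
    sumOver (derTerms r d z) (fun y => φ (Q.twistStr e y)) =
      (((e * d).negOnePow : ℤˣ) : ℤ) • sumOver (derTerms r d (Q.twistStr e z)) φ := by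
  induction z with
  | nil X =>
    simp only [sumOver_derTerms_nil, Str.single, GradedQuiver.twistStr_cons, twist_apply hr hd,
      GradedQuiver.twistStr_nil, hφ.head_zsmul]
  | cons x p ih =>
    rw [sumOver_derTerms_cons, GradedQuiver.twistStr_cons, sumOver_derTerms_cons, smul_add,
      ← GradedQuiver.twistStr_cons]
    simp only [GradedQuiver.twistStr_cons e x]
    rw [ih (hφ.cons _)]
    congr 1
    rw [← GradedQuiver.twistStr_cons]
    rw [headSum, headSum, GradedQuiver.cutSum_twistStr]
    simp only [GradedQuiver.twistStr_cons, twist_apply hr hd,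
      hφ.head_zsmul, Str.cutSum_zsmul, GradedQuiver.twistStr_twistStr, add_comm]

/-- The terms of two coderivations applied in succession, the second one to a segment to the right
of the first one. -/
noncomputable def disjointSum (r : ∀ ⦃X Y : Q.Obj⦄, Q.Tens X Y → Q.Hom X Y) (d : ℤ)
    (s : ∀ ⦃X Y : Q.Obj⦄, Q.Tens X Y → Q.Hom X Y) (e : ℤ) :
    {X Y : Q.Obj} → (z : Q.Tens X Y) → (Q.Tens X Y → M) → M
  | _, _, .nil X, φ => sumOver (derTerms s e (.nil X)) fun t => φ (.cons (r (.nil X)) t)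
  | _, _, .cons x p, φ =>
      (Str.cutSum (.cons x p) fun _ a t =>
        sumOver (derTerms s e (Q.twistStr d t)) fun t' => φ (.cons (r a) t')) +
      disjointSum r d s e p fun q => φ (.cons x q)

/-- The composition of two coderivations: the second one is applied either to a segment containing
the output of the first one, or to its right, or to its left. -/
theorem sumOver_derTerms_derTerms (hr : ∀ X Y : Q.Obj, MultilinearOn (@r X Y)) {d : ℤ}
    (hd : IsOfDegree (R := Q) (F := fun X => X) (G := fun X => X) r d)
    (e : ℤ) {X Y : Q.Obj} {φ : Q.Tens X Y → M} (hφ : MultilinearOn φ) (z : Q.Tens X Y) :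
    sumOver (derTerms r d z) (fun y => sumOver (derTerms s e y) φ) =
      sumOver (derTerms (fun _ _ a => sumOver (derTerms r d a) fun y => s y) (d + e) z) φ +
      disjointSum r d s e z φ +
      (((e * d).negOnePow : ℤˣ) : ℤ) • disjointSum s e r d z φ := by
  -- When `s` consumes an initial segment, `r` has acted either inside that segment or to its right.
  -- In the second case, moving the twist of `s` past `r` produces the sign.
  have der_head : ∀ {A B : Q.Obj} {φ : Q.Tens A B → M} (_ : MultilinearOn φ) (z : Q.Tens A B),
      sumOver (derTerms r d z) (fun y => headSum s e y φ) =
        headSum (fun _ _ a => sumOver (derTerms r d a) fun y => s y) (d + e) z φ +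
        (((e * d).negOnePow : ℤˣ) : ℤ) • z.cutSum fun _ a t =>
          sumOver (derTerms r d (Q.twistStr e t)) fun t' => φ (.cons (s a) t') := by
    intro A B φ hφ z
    simp only [headSum, sumOver_derTerms_cutSum, GradedQuiver.twistStr_twistStr, hφ.head_sumOver,
      ← Str.cutSum_zsmul, add_comm e d]
    congr 1
    exact Str.cutSum_congr _ fun Z a t _ => sumOver_derTerms_twistStr hr hd e (hφ.cons (s a)) t
  induction z with
  | nil X =>
    have h := der_head hφ (.nil X)
    simp only [sumOver_derTerms_nil, Str.single, headSum, Str.cutSum_nil, Str.cutSum_cons,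
      GradedQuiver.twistStr_nil, sumOver_derTerms_cons, disjointSum] at h ⊢
    rw [h]
    abel
  | cons x p ih =>
    have h := der_head hφ (.cons x p)
    rw [sumOver_derTerms_cons] at h
    rw [sumOver_derTerms_cons]
    simp only [sumOver_derTerms_cons s, sumOver_add]
    rw [ih (hφ.cons x)]
    -- Here `r` has acted at the head: `s` then either consumes an initial segment or leaves the
    -- head `r a` untouched and acts to its right.
    have h2 : headSum r d (.cons x p) (fun y => sumOver (derTerms s e y) φ) =
        headSum r d (.cons x p) (fun y => headSum s e y φ) +
        Str.cutSum (.cons x p) fun _ a t =>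
          sumOver (derTerms s e (Q.twistStr d t)) fun t' => φ (.cons (r a) t') := by
      simp only [headSum, sumOver_derTerms_cons, Str.cutSum_add]
    rw [h2, sumOver_derTerms_cons, disjointSum, disjointSum, smul_add]
    rw [← eq_sub_iff_add_eq] at h
    rw [h]
    abel

end

end AInf

/-! ### Coderivations as functions of their components; the identity functor. -/

namespace AInf

variable {k : Type w} [CommRing k]

section DerTerms

variable {Q : GradedQuiver.{w, u, v} k} {M : Type*} [AddCommGroup M] [Module k M]
  {r s : ∀ ⦃X Y : Q.Obj⦄, Q.Tens X Y → Q.Hom X Y}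

omit [Module k M] in
/-- The dependence of a coderivation on its components. -/
theorem sumOver_derTerms_congr (d : ℤ) {X Y : Q.Obj} (z : Q.Tens X Y) (φ : Q.Tens X Y → M)
    (h : ∀ {A B : Q.Obj} (a : Q.Tens A B), a.length ≤ z.length → r a = s a) :
    sumOver (derTerms r d z) φ = sumOver (derTerms s d z) φ := by
  simp only [sumOver_derTerms_eq_cutSum, headSum]
  refine Str.cutSum_congr _ fun Z p q hpq => Str.cutSum_congr _ fun W a t hat => ?_
  rw [h a (by omega)]

omit [Module k M] in
theorem sumOver_derTerms_congr_right (d : ℤ) {X Y : Q.Obj} (z : Q.Tens X Y) (φ ψ : Q.Tens X Y → M)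
    (h : ∀ y : Q.Tens X Y, y.length ≤ z.length + 1 → φ y = ψ y) :
    sumOver (derTerms r d z) φ = sumOver (derTerms r d z) ψ := by
  simp only [sumOver_derTerms_eq_cutSum, headSum]
  refine Str.cutSum_congr _ fun Z p q hpq => Str.cutSum_congr _ fun W a t hat => h _ ?_
  simp; omega

theorem sumOver_derTerms_zero (d : ℤ) {X Y : Q.Obj} (z : Q.Tens X Y) {φ : Q.Tens X Y → M}
    (hφ : MultilinearOn φ) : sumOver (derTerms (fun _ _ _ => 0) d z) φ = 0 := by
  simp [sumOver_derTerms_eq_cutSum, headSum, hφ.map_zero]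

theorem sumOver_derTerms_sub (d : ℤ) {X Y : Q.Obj} (z : Q.Tens X Y) {φ : Q.Tens X Y → M}
    (hφ : MultilinearOn φ) :
    sumOver (derTerms (fun _ _ a => r a - s a) d z) φ =
      sumOver (derTerms r d z) φ - sumOver (derTerms s d z) φ := by
  rw [eq_sub_iff_add_eq]
  simp only [sumOver_derTerms_eq_cutSum, headSum, ← Str.cutSum_add, ← (hφ _ _).map_add]
  simp

theorem sumOver_derTerms_add (d : ℤ) {X Y : Q.Obj} (z : Q.Tens X Y) {φ : Q.Tens X Y → M}
    (hφ : MultilinearOn φ) :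
    sumOver (derTerms (fun _ _ a => r a + s a) d z) φ =
      sumOver (derTerms r d z) φ + sumOver (derTerms s d z) φ := by
  simp only [sumOver_derTerms_eq_cutSum, headSum, ← Str.cutSum_add, ← (hφ _ _).map_add]

theorem sumOver_derTerms_zsmul (n d : ℤ) {X Y : Q.Obj} (z : Q.Tens X Y) {φ : Q.Tens X Y → M}
    (hφ : MultilinearOn φ) :
    sumOver (derTerms (fun _ _ a => n • r a) d z) φ = n • sumOver (derTerms r d z) φ := by
  have h : ∀ {A B : Q.Obj} (p : Q.Tens X A) (x : Q.Hom A B) (q : Q.Tens B Y),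
      φ (p.append (.cons (n • x) q)) = n • φ (p.append (.cons x q)) :=
    fun p x q => map_zsmul (IsLinearMap.mk' _ (hφ p q)) n x
  simp only [sumOver_derTerms_eq_cutSum, headSum, h, Str.cutSum_zsmul]

/-- If `r` vanishes on strings shorter than `z`, only `r z` contributes to the value on `z`. -/
theorem sumOver_derTerms_eq_single (d : ℤ) {X Y : Q.Obj} (z : Q.Tens X Y) {φ : Q.Tens X Y → M}
    (hφ : MultilinearOn φ) (h : ∀ {A B : Q.Obj} (a : Q.Tens A B), a.length < z.length → r a = 0) :
    sumOver (derTerms r d z) φ = φ (.single (r z)) := by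
  cases z with
  | nil X => exact sumOver_derTerms_nil r d X φ
  | cons x p =>
    rw [sumOver_derTerms_cons, sumOver_derTerms_congr (s := fun _ _ _ => 0) d p,
      sumOver_derTerms_zero d p (hφ.cons x), add_zero, headSum, Str.cutSum_eq_last]
    · rfl
    · intro Z a t ha
      rw [h a ha, hφ.head_zero]
    · intro A B a ha
      exact h a (by simp; omega)

theorem isOfDegree_sumOver_derTerms {d e : ℤ}
    (hr : IsOfDegree (R := Q) (F := fun X => X) (G := fun X => X) r d)
    (hs : IsOfDegree (R := Q) (F := fun X => X) (G := fun X => X) s e) :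
    IsOfDegree (R := Q) (F := fun X => X) (G := fun X => X)
      (fun _ _ z => sumOver (derTerms r d z) fun y => s y) (d + e) := by
  intro X Y z c hz
  have list_mem : ∀ (N : Submodule k (Q.Hom X Y)) (l : List (Q.Tens X Y)),
      (∀ y ∈ l, s y ∈ N) → sumOver l (fun y => s y) ∈ N := by
    intro N l hl
    refine list_sum_mem fun x hx => ?_
    obtain ⟨y, hy, rfl⟩ := List.mem_map.1 hx
    exact hl y hy
  have cut_deg : ∀ {A B : Q.Obj} (z : Q.Tens A B) (c : ℤ), Q.HasDegree z c →
      ∀ t ∈ z.cuts, ∃ a b, Q.HasDegree t.2.1 a ∧ Q.HasDegree t.2.2 b ∧ c = a + b := by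
    intro A B z
    induction z with
    | nil X =>
      rintro c hc t ht
      obtain rfl : t = _ := by simpa [Str.cuts] using ht
      exact ⟨c, 0, hc, rfl, by simp⟩
    | cons x p ih =>
      rintro c hc t ht
      rw [Str.cuts, List.mem_cons] at ht
      rcases ht with rfl | ht
      · exact ⟨0, c, rfl, hc, by simp⟩
      · obtain ⟨t', ht', rfl⟩ := List.mem_map.1 ht
        obtain ⟨a, b, hx, hp, rfl⟩ := hc
        obtain ⟨a', b', h1, h2, rfl⟩ := ih b hp _ ht'
        exact ⟨a + a', b', ⟨a, a', hx, h1, rfl⟩, h2, by ring⟩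
  refine list_mem _ _ fun y hy => ?_
  simp only [derTerms, List.mem_flatMap, List.mem_map] at hy
  obtain ⟨t, ht, t', ht', rfl⟩ := hy
  obtain ⟨a, b, h1, h2, rfl⟩ := cut_deg z c hz t ht
  obtain ⟨a', b', h1', h2', rfl⟩ := cut_deg _ b h2 t' ht'
  have h3 : Q.HasDegree (.cons (r t'.2.1) (Q.twistStr d t'.2.2)) ((a' + d) + b') :=
    ⟨a' + d, b', hr _ _ h1', h2'.twistStr d, rfl⟩
  convert hs _ _ (h1.append h3) using 2
  ring

end DerTerms

theorem sum_map_flatMap {α β M : Type*} [AddCommMonoid M] (l : List α) (f : α → List β)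
    (φ : β → M) : ((l.flatMap f).map φ).sum = (l.map fun a => ((f a).map φ).sum).sum := by
  simp [List.flatMap_def, List.map_flatten, List.sum_flatten, Function.comp_def]

section Identity

variable {A : AInfCat.{w, u, v} k}

/-- Only the decomposition into blocks of length one survives: any longer block is sent to zero, and
`φ` vanishes on a string with a zero entry. -/
theorem PreFunctor.sumOver_terms_ident {M : Type*} [AddCommGroup M] [Module k M] {X Y : A.Obj}
    (z : A.Tens X Y) {φ : A.Tens X Y → M} (hφ : MultilinearOn φ) :
    sumOver ((PreFunctor.ident A).terms z) φ = φ z := by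
  -- Prepending an entry to an empty block would give a block of length one, on which the identity
  -- functor is not zero; this has to be excluded.
  have block_ne : ∀ {X Y : A.Obj} (z : A.Tens X Y) {Z : A.Obj} (q : A.Tens X Z)
      (P : Str A.Tens Z Y), Str.cons q P ∈ z.blocks → 0 < q.length := by
    intro X Y z Z q P h
    cases z with
    | nil => simp [Str.blocks] at h
    | cons x p =>
      simp only [Str.blocks, List.mem_flatMap] at h
      obtain ⟨R, -, hR⟩ := h
      cases R with
      | nil => 
        obtain ⟨rfl, h⟩ := by simpa using hR
        obtain ⟨rfl, -⟩ := by simpa using h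
        simp [Str.single]
      | cons q' P' =>
        simp only [List.mem_cons, List.not_mem_nil, or_false] at hR
        rcases hR with hR | hR <;> cases hR <;> simp [Str.single]
  have key : ∀ {X Y : A.Obj} (z : A.Tens X Y) {φ : A.Tens X Y → M}, MultilinearOn φ →
      (z.blocks.map fun P => φ (P.map (V' := A.Hom) (fun X => X)
        fun q => (PreFunctor.ident A).comp q)).sum = φ z := by
    intro X Y z φ hφ
    induction z with
    | nil X => simp [Str.blocks, Str.map]
    | cons x p ih =>
      rw [← ih (hφ.cons x), Str.blocks, sum_map_flatMap]
      refine congrArg List.sum (List.map_congr_left fun P hP => ?_)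
      cases P with
      | nil => simp [Str.map, Str.single, PreFunctor.ident]
      | cons q P =>
        have hq := block_ne p q P hP
        cases q with
        | nil => simp at hq
        | cons y q =>
          simpa [Str.map, Str.single, PreFunctor.ident] using hφ.head_zero _
  exact (congrArg List.sum List.map_map).trans (key z hφ)

theorem sumOver_coderTerms_ident {M : Type*} [AddCommGroup M] [Module k M] (d : ℤ)
    {r : Components A.toGradedQuiver A.toGradedQuiver (PreFunctor.ident A).obj
      (PreFunctor.ident A).obj} {X Y : A.Obj}
    (z : A.Tens X Y) {φ : A.Tens X Y → M} (hφ : MultilinearOn φ) :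
    sumOver (coderTerms (PreFunctor.ident A) (PreFunctor.ident A) d r z) φ =
      sumOver (derTerms (Q := A.toGradedQuiver) r d z) φ := by
  have h1 := fun {Z W : A.Obj} (p : A.Tens X Z) (x : A.Hom Z W) (q : A.Tens W Y) =>
    PreFunctor.sumOver_terms_ident q ((hφ.append_left p).cons x)
  have h2 : ∀ {Z W : A.Obj} (p : A.Tens X Z) (x : A.Hom Z W) (q : A.Tens W Y),
    sumOver ((PreFunctor.ident A).terms p) (fun p => φ (p.append (.cons x q))) = 
      φ (p.append (.cons x q)) := by
    intro Z W p x q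
    refine PreFunctor.sumOver_terms_ident (φ := fun p => φ (p.append (.cons x q))) p ?_
    intro A B p' q'
    simpa only [Str.append_assoc, Str.cons_append] using hφ p' (q'.append (.cons x q))
  simp only [sumOver] at h1 h2
  refine (sum_map_flatMap _ _ _).trans (Eq.trans ?_ (sum_map_flatMap _ _ _).symm)
  refine congrArg List.sum (List.map_congr_left fun c _ => ?_)
  refine (sum_map_flatMap _ _ _).trans (Eq.trans ?_ (congrArg List.sum List.map_map).symm)
  refine congrArg List.sum (List.map_congr_left fun c' _ => ?_)
  refine (sum_map_flatMap _ _ _).trans ?_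
  refine (congrArg List.sum (List.map_congr_left fun P _ =>
    (congrArg List.sum List.map_map).trans (h1 P _ _))).trans ?_
  exact h2 c.2.1 (r c'.2.1) (A.twistStr d c'.2.2)

end Identity

end AInf

/-! ### The commutator with `b`, and integration of its cycles in a contractible category. -/

namespace AInf

variable {k : Type w} [CommRing k]

namespace AInfCat

variable (A : AInfCat.{w, u, v} k)

theorem multilinearOn_b (X Y : A.Obj) : MultilinearOn (@A.b X Y) :=
  fun _ _ p q => A.b_multilinear p q

/-- The components `v b - (-1)^d b v` of the commutator of an `(id, id)`-coderivation `v` of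
degree `d` with `b`. -/
noncomputable def bracket (r : ∀ ⦃X Y : A.Obj⦄, A.Tens X Y → A.Hom X Y) (d : ℤ) ⦃X Y : A.Obj⦄
    (z : A.Tens X Y) : A.Hom X Y :=
  sumOver (derTerms r d z) (fun y => A.b y) -
    ((d.negOnePow : ℤˣ) : ℤ) • sumOver (derTerms A.b 1 z) (fun y => r y)

variable {A}

theorem _root_.AInf.Coder.multilinearOn {B : AInfCat.{w, u, v} k} {f g : PreFunctor A B} {d : ℤ}
    (r : Coder f g d) (X Y : A.Obj) : MultilinearOn (@r.comp X Y) :=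
  fun _ _ p q => r.multilinear p q

/-- Replaces block decompositions by `derTerms`, to which the composition formula for coderivations
applies. -/
theorem B₁_ident {d : ℤ} (r : Coder (PreFunctor.ident A) (PreFunctor.ident A) d) {X Y : A.Obj}
    (z : A.Tens X Y) : B₁ r z = A.bracket r.comp d z :=
  congrArg (· - ((d.negOnePow : ℤˣ) : ℤ) • sumOver (derTerms A.b 1 z) (fun y => r.comp y))
    (sumOver_coderTerms_ident d z (A.multilinearOn_b X Y))

section

variable {r s : ∀ ⦃X Y : A.Obj⦄, A.Tens X Y → A.Hom X Y} {d : ℤ}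

theorem multilinearOn_bracket (hr : ∀ X Y, MultilinearOn (@r X Y)) (X Y : A.Obj) :
    MultilinearOn fun z : A.Tens X Y => A.bracket r d z :=
  ((A.multilinearOn_b X Y).sumOver_derTerms hr d).sub
    (((hr X Y).sumOver_derTerms A.multilinearOn_b 1).zsmul _)

theorem isOfDegree_bracket
    (hd : IsOfDegree (R := A.toGradedQuiver) (F := fun X => X) (G := fun X => X) r d) :
    IsOfDegree (R := A.toGradedQuiver) (F := fun X => X) (G := fun X => X)
      (A.bracket r d) (d + 1) := by
  intro X Y z c hz
  refine sub_mem (isOfDegree_sumOver_derTerms hd A.b_degree z c hz) (zsmul_mem ?_ _)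
  rw [add_comm d]
  exact isOfDegree_sumOver_derTerms A.b_degree hd z c hz

theorem bracket_add {X Y : A.Obj} (z : A.Tens X Y) :
    A.bracket (fun _ _ z => r z + s z) d z = A.bracket r d z + A.bracket s d z := by
  simp only [bracket, sumOver_derTerms_add d z (A.multilinearOn_b X Y), sumOver_add, smul_add]
  abel

theorem bracket_sub {X Y : A.Obj} (z : A.Tens X Y) :
    A.bracket (fun _ _ z => r z - s z) d z = A.bracket r d z - A.bracket s d z := by
  simp only [bracket, sumOver_derTerms_sub d z (A.multilinearOn_b X Y), sumOver_sub, smul_sub]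
  abel

theorem bracket_congr {X Y : A.Obj} (z : A.Tens X Y)
    (h : ∀ {A' B' : A.Obj} (a : A.Tens A' B'), a.length ≤ z.length + 1 → r a = s a) :
    A.bracket r d z = A.bracket s d z := by
  rw [bracket, bracket, sumOver_derTerms_congr d z _ fun a ha => h a (by omega),
    sumOver_derTerms_congr_right 1 z (fun y => r y) (fun y => s y) fun y hy => h y hy]

/-- The commutator with `b` is a differential. -/
theorem bracket_bracket (hr : ∀ X Y, MultilinearOn (@r X Y))
    (hd : IsOfDegree (R := A.toGradedQuiver) (F := fun X => X) (G := fun X => X) r d)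
    {X Y : A.Obj} (z : A.Tens X Y) : A.bracket (A.bracket r d) (d + 1) z = 0 := by
  have hb := A.multilinearOn_b X Y
  have hbb : ∀ {X Y : A.Obj} (z : A.Tens X Y),
      sumOver (derTerms A.b 1 z) (fun y => A.b y) = 0 := A.b_b
  -- The three double compositions `r b b`, `b r b`, `b b r`. Those with two adjacent `b` vanish by
  -- `b² = 0`, and the disjoint terms cancel by the Koszul signs.
  have h1 := sumOver_derTerms_derTerms hr hd (s := A.b) 1 hb z
  have h2 := sumOver_derTerms_derTerms A.multilinearOn_b A.b_degree (s := r) d hb z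
  have h3 := sumOver_derTerms_derTerms A.multilinearOn_b A.b_degree (s := A.b) 1 (hr X Y) z
  simp only [hbb, sumOver_zero, sumOver_derTerms_zero _ z (hr X Y), one_mul, mul_one,
    Int.negOnePow_one, Units.val_neg, Units.val_one, neg_smul, one_smul, zero_add,
    add_neg_cancel] at h1 h2 h3
  have hsub : sumOver (derTerms (A.bracket r d) (d + 1) z) (fun y => A.b y) =
      sumOver (derTerms (fun _ _ a => sumOver (derTerms r d a) fun y => A.b y) (d + 1) z)
        (fun y => A.b y) - ((d.negOnePow : ℤˣ) : ℤ) •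
      sumOver (derTerms (fun _ _ a => sumOver (derTerms A.b 1 a) fun y => r y) (d + 1) z)
        (fun y => A.b y) := by
    rw [← sumOver_derTerms_zsmul _ _ z hb, ← sumOver_derTerms_sub _ z hb]
    rfl
  rw [bracket, hsub]
  simp only [bracket, sumOver_sub, sumOver_zsmul, h2, h3, Int.negOnePow_succ, Units.val_neg,
    add_comm 1 d, smul_zero, sub_zero]
  rw [add_assoc, eq_comm, ← eq_neg_iff_add_eq_zero] at h1
  rw [h1]
  rcases Int.units_eq_one_or d.negOnePow with hε | hε <;> simp [hε] <;> abel

end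

/-- In a contractible category every cycle of the complex of `(id, id)`-coderivations of degree
`-1` is a boundary. -/
theorem IsContractible.exists_bracket_eq (hA : A.IsContractible)
    {r : ∀ ⦃X Y : A.Obj⦄, A.Tens X Y → A.Hom X Y} (hr : ∀ X Y, MultilinearOn (@r X Y))
    (hd : IsOfDegree (R := A.toGradedQuiver) (F := fun X => X) (G := fun X => X) r (-1))
    (hcyc : ∀ {X Y : A.Obj} (z : A.Tens X Y), A.bracket r (-1) z = 0) :
    ∃ v : Coder (PreFunctor.ident A) (PreFunctor.ident A) (-2),
      ∀ {X Y : A.Obj} (z : A.Tens X Y), B₁ v z = r z := by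
  choose h hdeg hh using hA
  -- `E v` is the error of the approximate primitive `v`. Each stage of `V` adds the contracting
  -- homotopy of the error, which pushes the error to longer strings.
  let E : (∀ ⦃X Y : A.Obj⦄, A.Tens X Y → A.Hom X Y) → ∀ ⦃X Y : A.Obj⦄, A.Tens X Y → A.Hom X Y :=
    fun v X Y z => r z - A.bracket v (-2) z
  let V : ℕ → ∀ ⦃X Y : A.Obj⦄, A.Tens X Y → A.Hom X Y := fun n => Nat.rec (fun _ _ _ => 0)
    (fun _ v X Y z => v z + h X Y (E v z)) n
  have V_succ : ∀ n, V (n + 1) = fun X Y z => V n z + h X Y (E (V n) z) := fun n => rfl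
  have V_spec : ∀ n, (∀ X Y, MultilinearOn fun z : A.Tens X Y => V n z) ∧
      IsOfDegree (R := A.toGradedQuiver) (F := fun X => X) (G := fun X => X) (V n) (-2) := by
    intro n
    induction n with
    | zero =>
      exact ⟨fun X Y A' B' p q => (0 : A.Hom A' B' →ₗ[k] A.Hom X Y).isLinear,
        fun _ _ _ => zero_mem _⟩
    | succ n ih =>
      refine ⟨fun X Y => (ih.1 X Y).add (((hr X Y).sub
        (multilinearOn_bracket ih.1 X Y)).comp_linear (h X Y)), fun {X Y} z c hz => ?_⟩
      refine add_mem (ih.2 z c hz) ?_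
      have := hdeg X Y _ _ (sub_mem (hd z c hz) (isOfDegree_bracket ih.2 z c hz))
      rwa [add_assoc] at this
  have E_lin : ∀ n X Y, MultilinearOn fun z : A.Tens X Y => E (V n) z := fun n X Y =>
    (hr X Y).sub (multilinearOn_bracket (V_spec n).1 X Y)
  have E_cyc : ∀ n {X Y : A.Obj} (z : A.Tens X Y), A.bracket (E (V n)) (-1) z = 0 := by
    intro n X Y z
    refine (bracket_sub z).trans ?_
    rw [hcyc, zero_sub, neg_eq_zero]
    exact bracket_bracket (V_spec n).1 (V_spec n).2 z
  have E_zero : ∀ n {X Y : A.Obj} (z : A.Tens X Y), z.length < n → E (V n) z = 0 := by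
    intro n
    induction n with
    | zero => intro X Y z hz; omega
    | succ n ih =>
      intro X Y z hz
      have hlow : ∀ {A' B' : A.Obj} (a : A.Tens A' B'), a.length < z.length → E (V n) a = 0 :=
        fun a ha => ih a (by omega)
      -- The error is a cycle and vanishes on shorter strings, so in its first sum only the term
      -- with the whole of `z` as argument remains.
      have h1 : A.b₁ (E (V n) z) + sumOver (derTerms A.b 1 z) (fun y => E (V n) y) = 0 := by
        have := E_cyc n z
        rw [bracket, sumOver_derTerms_eq_single _ z (A.multilinearOn_b X Y) hlow] at this
        simpa [b₁] using this
      -- By `h1` the commutator of the correction becomes `b₁ h + h b₁` applied to the error at `z`,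
      -- which is the error itself.
      have h2 : A.bracket (fun X Y z => h X Y (E (V n) z)) (-2) z = E (V n) z := by
        rw [bracket, sumOver_derTerms_eq_single _ z (A.multilinearOn_b X Y)
          fun a ha => by rw [hlow a ha, map_zero]]
        have h3 := map_sumOver (h X Y).toAddMonoidHom (derTerms A.b 1 z) fun y => E (V n) y
        simp only [LinearMap.toAddMonoidHom_coe] at h3
        rw [← h3, ← neg_eq_of_add_eq_zero_right h1, map_neg]
        have := hh X Y (E (V n) z)
        rw [sub_zero] at this
        simpa [Int.negOnePow_even, b₁] using this.symm
      have h3 := bracket_add (d := -2) (r := V n) (s := fun X Y z => h X Y (E (V n) z)) z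
      change r z - A.bracket (V (n + 1)) (-2) z = 0
      rw [V_succ, h3, h2]
      simp [E]
  have V_stable : ∀ m n {X Y : A.Obj} (z : A.Tens X Y), z.length < n → V (n + m) z = V n z := by
    intro m n X Y z hz
    induction m with
    | zero => rfl
    | succ m ih =>
      rw [← add_assoc, V_succ]
      simp only
      rw [E_zero _ z (by omega), map_zero, add_zero, ih]
  -- The limit of the stages: `V n z` no longer changes once `n` exceeds the length of `z`.
  let W : ∀ ⦃X Y : A.Obj⦄, A.Tens X Y → A.Hom X Y := fun X Y z => V (z.length + 1) z
  have W_eq : ∀ n {X Y : A.Obj} (z : A.Tens X Y), z.length < n → W z = V n z := by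
    intro n X Y z hz
    obtain ⟨m, rfl⟩ := Nat.exists_eq_add_of_le hz
    exact (V_stable m (z.length + 1) z (by omega)).symm
  refine ⟨⟨W, fun {X A' B' Y} p q => ?_, fun {X Y} z c hz =>
    (V_spec (z.length + 1)).2 z c hz⟩,
    fun {X Y} z => ?_⟩
  · have : (fun x : A.Hom A' B' => W (p.append (.cons x q))) =
        fun x => V (p.length + q.length + 2) (p.append (.cons x q)) := by
      funext x
      exact W_eq (p.length + q.length + 2) (p.append (.cons x q))
         (by simp only [Str.length_append, Str.length_cons]; omega)
    exact this ▸ (V_spec (p.length + q.length + 2)).1 X Y p q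
  · rw [B₁_ident]
    -- Formally the commutator at `z` involves strings one entry longer than `z`, from inserting `b`
    -- of an empty string; hence the stage `z.length + 2`.
    refine (bracket_congr (s := V (z.length + 2)) z fun a ha =>
      W_eq (z.length + 2) a (by omega)).trans ?_
    exact (sub_eq_zero.1 (E_zero (z.length + 2) z (by omega))).symm

end AInfCat

end AInf

/-! ### Low-order identities, contractibility from units, and values on the empty string. -/

namespace AInf

variable {k : Type w} [CommRing k]

namespace AInfCat

variable {A : AInfCat.{w, u, v} k} {X Y Z : A.Obj}

theorem isLinearMap_b₁ (X Y : A.Obj) : IsLinearMap k fun x : A.Hom X Y => A.b₁ x :=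
  A.b_multilinear (.nil X) (.nil Y)

theorem isLinearMap_b₂_right (v : A.Hom X Y) (Z : A.Obj) :
    IsLinearMap k fun x : A.Hom Y Z => A.b₂ v x :=
  A.b_multilinear (.single v) (.nil Z)

theorem b₁_mem {x : A.Hom X Y} {d : ℤ} (hx : x ∈ A.gr X Y d) : A.b₁ x ∈ A.gr X Y (d + 1) := by
  simpa [b₁] using A.b_degree (.single x) (d + 0) ⟨d, 0, hx, rfl, rfl⟩

theorem b₂_mem {x : A.Hom X Y} {y : A.Hom Y Z} {d e : ℤ} (hx : x ∈ A.gr X Y d)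
    (hy : y ∈ A.gr Y Z e) : A.b₂ x y ∈ A.gr X Z (d + e + 1) := by
  simpa [b₂] using
    A.b_degree (.cons x (.single y)) (d + (e + 0)) ⟨d, e + 0, hx, ⟨e, 0, hy, rfl, rfl⟩, rfl⟩

/-- The operation `b₂` is a chain map. -/
theorem b₂_chain (x : A.Hom X Y) (y : A.Hom Y Z) :
    A.b₂ (A.b₁ x) (A.twist 1 y) + A.b₂ x (A.b₁ y) + A.b₁ (A.b₂ x y) = 0 := by
  have h := A.b_b (.cons x (.single y))
  have hb := A.multilinearOn_b
  simp only [sumOver_derTerms_cons, sumOver_derTerms_nil, headSum, Str.single, Str.cutSum_cons,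
    Str.cutSum_nil, A.b_nil, (hb _ _).head_zero, ((hb _ _).cons _).head_zero,
    (((hb _ _).cons _).cons _).head_zero, zero_add, add_zero, GradedQuiver.twistStr_cons,
    GradedQuiver.twistStr_nil] at h
  rw [← h, b₂, b₂, b₁, b₁, b₁, b₂]
  simp only [Str.single]
  abel

/-- Reconciles the sign of the degree `-1` unit with that of the degree `1` operation in `b₂_chain`.
-/
theorem twist_neg (Q : GradedQuiver.{w, u, v} k) (d : ℤ) {X Y : Q.Obj} (x : Q.Hom X Y) :
    Q.twist (-d) x = Q.twist d x := by
  simp only [GradedQuiver.twist, neg_mul, Int.negOnePow_neg]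

/-- A homogeneous boundary is the boundary of a homogeneous element. -/
theorem exists_homogeneous_b₁_eq {y : A.Hom X Y} {d : ℤ} (h : A.b₁ y ∈ A.gr X Y (d + 1)) :
    ∃ x ∈ A.gr X Y d, A.b₁ x = A.b₁ y := by
  have hy : y ∈ ⨆ e, A.gr X Y e := by
    rw [(A.isInternal X Y).submodule_iSup_eq_top]; trivial
  have hlin := isLinearMap_b₁ X Y
  -- `x` is the degree `d` part of `y`. The other parts have boundaries outside degree `d + 1`, and
  -- independence of the grading makes their sum zero.
  have key : ∃ x ∈ A.gr X Y d, A.b₁ y - A.b₁ x ∈ ⨆ (e) (_ : e ≠ d + 1), A.gr X Y e := by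
    refine Submodule.iSup_induction (A.gr X Y) (motive := fun y => ∃ x ∈ A.gr X Y d,
      A.b₁ y - A.b₁ x ∈ ⨆ (e) (_ : e ≠ d + 1), A.gr X Y e) hy ?_ ?_ ?_
    · intro e y hy
      by_cases he : e = d
      · subst he
        exact ⟨y, hy, by simp⟩
      · refine ⟨0, zero_mem _, ?_⟩
        rw [hlin.map_zero, sub_zero]
        exact Submodule.mem_iSup_of_mem (e + 1)
          (Submodule.mem_iSup_of_mem (by simpa using he) (b₁_mem hy))
    · exact ⟨0, zero_mem _, by simp⟩
    · rintro y y' ⟨x, hx, h⟩ ⟨x', hx', h'⟩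
      refine ⟨x + x', add_mem hx hx', ?_⟩
      rw [hlin.map_add, hlin.map_add, add_sub_add_comm]
      exact add_mem h h'
  obtain ⟨x, hx, hxy⟩ := key
  have hdisj := (A.isInternal X Y).submodule_iSupIndep (d + 1)
  exact ⟨x, hx, (sub_eq_zero.1 (Submodule.disjoint_def.1 hdisj _ (sub_mem h (b₁_mem hx)) hxy)).symm⟩

theorem ContractibleHom.acyclicHom (h : A.ContractibleHom X Y) : A.AcyclicHom X Y := by
  obtain ⟨H, -, hH⟩ := h
  intro x hx
  refine ⟨H x, ?_⟩
  have := hH x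
  simp only [hx, map_zero, add_zero, sub_zero] at this
  exact this.symm

/-- If the unit of `X` is a boundary, then all complexes `sA(X, Y)` are contractible. -/
theorem UnitTransformation.contractibleHom (i : A.UnitTransformation) {x : A.Hom X X}
    (hx : x ∈ A.gr X X (-2)) (hi : i.comp (.nil X) = A.b₁ x) (Y : A.Obj) :
    A.ContractibleHom X Y := by
  obtain ⟨ψ, hψ, hψb, ⟨H, hH, hHψ⟩, -⟩ := i.left_invertible X Y
  have hlin := isLinearMap_b₁ X Y
  let L : A.Hom X Y →ₗ[k] A.Hom X Y := IsLinearMap.mk' _ (isLinearMap_b₂_right x Y)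
  -- `-L` contracts multiplication by the unit, `ψ` inverts that multiplication up to homotopy on
  -- one side, and `H` is that homotopy.
  refine ⟨-(ψ ∘ₗ L) - H, fun e y hy => ?_, fun y => ?_⟩
  · refine sub_mem (neg_mem ?_) (hH e y hy)
    have := hψ _ _ (b₂_mem hx hy)
    rwa [add_zero, show (-2 : ℤ) + e + 1 = e + -1 by ring] at this
  · have h1 : ψ (A.b₂ (A.b₁ x) (A.twist (-1) y)) - y = A.b₁ (H y) + H (A.b₁ y) :=
      (congrArg (fun t : A.Hom X X => ψ (A.b₂ t (A.twist (-1) y)) - y) hi).symm.trans (hHψ y)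
    have h2 := b₂_chain x y
    rw [add_assoc, add_eq_zero_iff_eq_neg] at h2
    rw [twist_neg, h2] at h1
    have e1 : A.b₁ ((-(ψ ∘ₗ L) - H) y) = - ψ (A.b₁ (A.b₂ x y)) - A.b₁ (H y) := by
      rw [hψb]
      exact ((IsLinearMap.mk' _ hlin).map_sub _ _).trans
        (congrArg (· - A.b₁ (H y)) ((IsLinearMap.mk' _ hlin).map_neg _))
    have e2 : (-(ψ ∘ₗ L) - H) (A.b₁ y) = - ψ (A.b₂ x (A.b₁ y)) - H (A.b₁ y) := rfl
    rw [e1, e2, sub_zero]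
    rw [map_neg, map_add, sub_eq_iff_eq_add] at h1
    rw [← sub_eq_zero] at h1 ⊢
    rw [← neg_eq_zero, ← h1]
    abel

end AInfCat

section Components

variable {A B : AInfCat.{w, u, v} k}

theorem Coder.map_zero {f g : PreFunctor A B} {d : ℤ} (r : Coder f g d) {X Y W Z : A.Obj}
    (p : A.Tens X Y) (q : A.Tens W Z) : r.comp (p.append (.cons 0 q)) = 0 :=
  (r.multilinearOn X Z).map_zero p q

theorem terms_nil (f : PreFunctor A B) (X : A.Obj) : f.terms (.nil X) = [.nil (f.obj X)] := by
  simp [PreFunctor.terms, Str.blocks, Str.map]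

theorem coderTerms_nil (f g : PreFunctor A B) (d : ℤ)
    (r : Components A.toGradedQuiver B.toGradedQuiver f.obj g.obj) (X : A.Obj) :
    coderTerms f g d r (.nil X) = [.single (r (.nil X))] := by
  simp [coderTerms, Str.cuts, terms_nil, Str.single]

/-- The second sum drops out because `b₀ = 0`. Thus naturality makes `r₀` a cycle, and equivalent
transformations have homologous components on the empty string. -/
theorem B₁_nil {f g : PreFunctor A B} {d : ℤ} (r : Coder f g d) (X : A.Obj) :
    B₁ r (.nil X) = B.b₁ (r.comp (.nil X)) := by
  have h : r.comp (.single (0 : A.Hom X X)) = 0 := r.map_zero (.nil X) (.nil X)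
  rw [B₁, coderTerms_nil, sumOver_derTerms_nil, A.b_nil, h]
  simp [sumOver, AInfCat.b₁]

theorem B₂_nil {f g h : PreFunctor A B} {d e : ℤ} (r : Coder f g d) (p : Coder g h e)
    (X : A.Obj) : B₂ r p (.nil X) = B.b₂ (r.comp (.nil X)) (p.comp (.nil X)) := by
  simp [B₂, thetaTerms, Str.cuts, terms_nil, coderTerms_nil, sumOver, AInfCat.b₂]

theorem Coder.comp_nil_mem {f g : PreFunctor A B} {d : ℤ} (r : Coder f g d) (X : A.Obj) :
    r.comp (.nil X) ∈ B.gr (f.obj X) (g.obj X) d := by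
  simpa using r.degree (.nil X) 0 rfl

theorem whiskerLeft_nil (f : PreFunctor A B) {C : AInfCat.{w, u, v} k} {g h : PreFunctor B C}
    {d : ℤ} (r : Coder g h d) (X : A.Obj) :
    whiskerLeft f r (.nil X) = r.comp (.nil (f.obj X)) := by
  simp only [whiskerLeft, terms_nil, sumOver]
  exact List.sum_singleton

theorem sumOver_eq_zero {S : Type*} {V : S → S → Type*} {X Y : S} {M : Type*} [AddCommGroup M]
    (l : List (Str V X Y)) {φ : Str V X Y → M} (h : ∀ y ∈ l, φ y = 0) : sumOver l φ = 0 :=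
  List.sum_eq_zero fun x hx => by
    obtain ⟨y, hy, rfl⟩ := List.mem_map.1 hx
    exact h y hy

/-- The zero coderivation. -/
def Coder.zero (f g : PreFunctor A B) (d : ℤ) : Coder f g d where
  comp := fun _ _ _ => 0
  multilinear := fun {X A' B' Y} _ _ =>
    (0 : A.Hom A' B' →ₗ[k] B.Hom (f.obj X) (g.obj Y)).isLinear
  degree := fun _ _ _ => zero_mem _

theorem B₁_zero (f g : PreFunctor A B) (d : ℤ) {X Y : A.Obj} (z : A.Tens X Y) :
    B₁ (Coder.zero f g d) z = 0 := by
  rw [B₁, sumOver_eq_zero, sumOver_eq_zero]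
  · simp
  · intro y _; rfl
  · intro y hy
    simp only [coderTerms, List.mem_flatMap, List.mem_map] at hy
    obtain ⟨_, -, _, -, P, -, R, -, rfl⟩ := hy
    exact (B.multilinearOn_b _ _).map_zero P R

theorem B₂_zero_left (f g : PreFunctor A B) (d : ℤ) {h : PreFunctor A B} {e : ℤ}
    (p : Coder g h e) {X Y : A.Obj} (z : A.Tens X Y) : B₂ (Coder.zero f g d) p z = 0 := by
  refine sumOver_eq_zero _ fun y hy => ?_
  simp only [thetaTerms, List.mem_flatMap, List.mem_map] at hy
  obtain ⟨_, -, _, -, P, -, R, -, rfl⟩ := hy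
  exact (B.multilinearOn_b _ _).map_zero P R

theorem sumOver_coderTerms (f g : PreFunctor A B) (d : ℤ)
    (r : Components A.toGradedQuiver B.toGradedQuiver f.obj g.obj) {X Y : A.Obj} (z : A.Tens X Y)
    {M : Type*} [AddCommGroup M] (φ : B.Tens (f.obj X) (g.obj Y) → M) :
    sumOver (coderTerms f g d r z) φ =
      (z.cuts.map fun c => (c.2.2.cuts.map fun c' => ((f.terms c.2.1).map fun P =>
        ((g.terms (A.twistStr d c'.2.2)).map fun R =>
          φ (P.append (.cons (r c'.2.1) R))).sum).sum).sum).sum := by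
  simp only [sumOver, coderTerms, sum_map_flatMap, List.map_map, Function.comp_def]

theorem Equivalent.symm {f g : PreFunctor A B}
    {r p : Components A.toGradedQuiver B.toGradedQuiver f.obj g.obj}
    (h : Equivalent f g r p) : Equivalent f g p r := by
  have neg_sum : ∀ {α : Type (max u v)} {M : Type v} [AddCommGroup M] (l : List α) (φ : α → M),
      (l.map fun a => -φ a).sum = -(l.map φ).sum := by
    intro α M _ l φ
    induction l with
    | nil => simp
    | cons a l ih => simp [ih]; abel
  obtain ⟨v, hv⟩ := h
  refine ⟨⟨fun _ _ z => -v.comp z, fun {X A' B' Y} p q =>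
    (-IsLinearMap.mk' _ (v.multilinear p q)).isLinear,
    fun z c hz => neg_mem (v.degree z c hz)⟩, fun {X Y} z => ?_⟩
  have h1 : sumOver (coderTerms f g (-2) (fun _ _ z => -v.comp z) z) (fun y => B.b y) =
      -sumOver (coderTerms f g (-2) v.comp z) fun y => B.b y := by
    have hb : ∀ {X' Y' Z' W' : B.Obj} (p : B.Tens X' Y') (x : B.Hom Y' Z') (q : B.Tens Z' W'),
        B.b (p.append (.cons (-x) q)) = -B.b (p.append (.cons x q)) := fun p x q =>
      (IsLinearMap.mk' _ (B.multilinearOn_b _ _ p q)).map_neg x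
    simp only [sumOver_coderTerms, hb, neg_sum]
  rw [← neg_sub, hv, B₁, B₁, h1]
  have h2 := sumOver_zsmul (derTerms A.b 1 z) (-1) fun y => v.comp y
  simp only [neg_smul, one_smul] at h2
  rw [h2]
  simp only [smul_neg]
  abel

theorem equivalent_of_eq {f g : PreFunctor A B}
    {r p : Components A.toGradedQuiver B.toGradedQuiver f.obj g.obj}
    (h : ∀ {X Y : A.Obj} (z : A.Tens X Y), r z = p z) : Equivalent f g r p :=
  ⟨Coder.zero f g (-2), fun z => by rw [h z, B₁_zero, sub_self]⟩

end Components

/-! ### Functors with zero components. -/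

section ZeroFunctor

variable {A B : AInfCat.{w, u, v} k} {f : PreFunctor A B}

theorem length_add_of_mem_cuts {S : Type*} {V : S → S → Type*} {X Y : S} (z : Str V X Y)
    (c : (Z : S) × Str V X Z × Str V Z Y) (hc : c ∈ z.cuts) :
    c.2.1.length + c.2.2.length = z.length := by
  induction z with
  | nil => obtain rfl : c = _ := by simpa [Str.cuts] using hc
           rfl
  | cons x p ih =>
    rw [Str.cuts, List.mem_cons] at hc
    rcases hc with rfl | hc
    · simp
    · obtain ⟨c', hc', rfl⟩ := List.mem_map.1 hc
      have := ih c' hc'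
      simp; omega

theorem length_pos_of_mem_blocks {S : Type*} {V : S → S → Type*} {X Y : S} (z : Str V X Y)
    (P : Str (Str V) X Y) (hP : P ∈ z.blocks) (hz : 0 < z.length) : 0 < P.length := by
  cases z with
  | nil => simp at hz
  | cons x p =>
    simp only [Str.blocks, List.mem_flatMap] at hP
    obtain ⟨R, -, hR⟩ := hP
    cases R with
    | nil =>
      rw [List.mem_singleton] at hR
      simp [hR]
    | cons q R =>
      rw [List.mem_cons, List.mem_singleton] at hR
      rcases hR with rfl | rfl <;> simp

/-- A nonempty string has a first block, which goes to zero; any multilinear function therefore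
kills all these terms. -/
theorem exists_cons_zero_of_mem_terms
    (hf : ∀ {X Y : A.Obj} (z : A.Tens X Y), f.comp z = 0) {X Y : A.Obj} (z : A.Tens X Y)
    (hz : 0 < z.length) (P : B.Tens (f.obj X) (f.obj Y)) (hP : P ∈ f.terms z) :
    ∃ (Z : B.Obj) (R : B.Tens Z (f.obj Y)), P = .cons 0 R := by
  obtain ⟨P, hP', rfl⟩ := List.mem_map.1 hP
  have hlen := length_pos_of_mem_blocks z P hP' hz
  cases P with
  | cons q P => exact ⟨_, _, congrArg (fun t => Str.cons t _) (hf q)⟩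
  | nil => simp at hlen

theorem whiskerLeft_of_comp_eq_zero (hf : ∀ {X Y : A.Obj} (z : A.Tens X Y), f.comp z = 0)
    {C : AInfCat.{w, u, v} k} {g h : PreFunctor B C}
    {d : ℤ} (r : Coder g h d) {X Y : A.Obj} (z : A.Tens X Y) (hz : 0 < z.length) :
    whiskerLeft f r z = 0 := by
  refine sumOver_eq_zero _ fun y hy => ?_
  obtain ⟨Z, R, rfl⟩ := exists_cons_zero_of_mem_terms hf z hz y hy
  exact r.map_zero (.nil _) R

theorem isAInfFunctor_of_comp_eq_zero (hf : ∀ {X Y : A.Obj} (z : A.Tens X Y), f.comp z = 0) :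
    IsAInfFunctor f where
  nil X := hf _
  multilinear {X A' B' Y} p q := by
    have : (fun y : A.Hom A' B' => f.comp (p.append (.cons y q))) = fun _ => 0 :=
      funext fun y => hf _
    exact this ▸ (0 : A.Hom A' B' →ₗ[k] B.Hom (f.obj X) (f.obj Y)).isLinear
  degree p e _ := by rw [hf]; exact zero_mem _
  comm {X Y} z := by
    rw [sumOver_eq_zero (derTerms A.b 1 z) fun y _ => hf y]
    refine sumOver_eq_zero _ fun y hy => ?_
    cases z with
    | nil =>
      rw [terms_nil, List.mem_singleton] at hy
      rw [hy, B.b_nil]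
    | cons x p =>
      obtain ⟨Z, R, rfl⟩ := exists_cons_zero_of_mem_terms hf _ (by simp) y hy
      exact (B.multilinearOn_b _ _).head_zero R

/-- A family concentrated on strings of length zero, with values boundaries, is equivalent to zero
as a transformation of a functor with zero components to itself. -/
theorem equivalent_zero_of_comp_eq_zero (hf : ∀ {X Y : A.Obj} (z : A.Tens X Y), f.comp z = 0)
    {s : Components A.toGradedQuiver B.toGradedQuiver f.obj f.obj}
    (hs : ∀ {X Y : A.Obj} (z : A.Tens X Y), 0 < z.length → s z = 0)
    (hb : ∀ X : A.Obj, ∃ x ∈ B.gr (f.obj X) (f.obj X) (-2), s (.nil X) = B.b₁ x) :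
    Equivalent f f s (fun _ _ _ => 0) := by
  choose x hx hsx using hb
  -- The primitive has only a component on empty strings, given by the chosen primitives of the
  -- values of `s`.
  let v : Components A.toGradedQuiver B.toGradedQuiver f.obj f.obj := fun X _ z =>
    match z with
    | .nil X => x X
    | .cons _ _ => 0
  have hv : ∀ {X Y : A.Obj} (z : A.Tens X Y), 0 < z.length → v z = 0 := by
    intro X Y z hz
    cases z with
    | nil => simp at hz
    | cons x p => rfl
  have hpos : ∀ {X A' B' Y : A.Obj} (p : A.Tens X A') (y : A.Hom A' B') (q : A.Tens B' Y),
      0 < (p.append (.cons y q)).length := by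
    intros; simp only [Str.length_append, Str.length_cons]; omega
  refine ⟨⟨v, fun {X A' B' Y} p q => ?_, fun {X Y} p e hp => ?_⟩, fun {X Y} z => ?_⟩
  · have : (fun y : A.Hom A' B' => v (p.append (.cons y q))) = fun _ => 0 :=
      funext fun y => hv _ (hpos p y q)
    exact this ▸ (0 : A.Hom A' B' →ₗ[k] B.Hom (f.obj X) (f.obj Y)).isLinear
  · cases p with
    | nil =>
      obtain rfl : e = 0 := hp
      simpa using hx _
    | cons x p => exact zero_mem _
  · cases z with
    | nil => rw [B₁_nil, hsx, sub_zero]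
    | cons y p =>
      rw [hs _ (by simp), B₁, sumOver_eq_zero, sumOver_eq_zero]
      · simp
      · intro t ht
        simp only [derTerms, List.mem_flatMap, List.mem_map] at ht
        obtain ⟨_, -, _, -, rfl⟩ := ht
        exact hv _ (hpos _ _ _)
      · intro t ht
        simp only [coderTerms, List.mem_flatMap, List.mem_map] at ht
        obtain ⟨c, hc, c', hc', P, hP, R, hR, rfl⟩ := ht
        have h1 := length_add_of_mem_cuts _ _ hc
        have h2 := length_add_of_mem_cuts _ _ hc'
        have hb := B.multilinearOn_b
        rw [Str.length_cons] at h1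
        -- The string is nonempty, so one of its three parts is; each case puts a zero into the
        -- argument of `b`.
        by_cases ha : 0 < c'.2.1.length
        · rw [hv _ ha, (hb _ _).map_zero]
        by_cases hp : 0 < c.2.1.length
        · obtain ⟨Z, R, rfl⟩ := exists_cons_zero_of_mem_terms hf _ hp P hP
          exact (hb _ _).head_zero _
        · obtain ⟨Z, R, rfl⟩ := exists_cons_zero_of_mem_terms hf _
            (by rw [GradedQuiver.length_twistStr]; omega) R hR
          exact (((hb _ _).append_left P).cons _).head_zero R

end ZeroFunctor

end AInf

/-! ### The category with zero morphisms, and the implications between the conditions. -/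

namespace AInf

variable {k : Type w} [CommRing k]

/-- The graded quiver with the given objects and zero morphisms. -/
abbrev GradedQuiver.zero (k : Type w) [CommRing k] (S : Type u) : GradedQuiver.{w, u, v} k where
  Obj := S
  Hom _ _ := PUnit
  gr _ _ _ := ⊤
  isInternal _ _ := by
    refine ⟨fun a b _ => DFinsupp.ext fun _ => Subsingleton.elim _ _, fun y => ⟨?_, ?_⟩⟩
    · exact (DFinsupp.mk ∅ fun _ => 0)
    · exact Subsingleton.elim _ _

/-- The `A_∞`-category with the given objects and zero morphisms. -/
def AInfCat.zero (k : Type w) [CommRing k] (S : Type u) : AInfCat.{w, u, v} k where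
  toGradedQuiver := GradedQuiver.zero k S
  b _ _ _ := PUnit.unit
  b_nil _ := rfl
  b_multilinear _ _ := ⟨fun _ _ => rfl, fun _ _ => rfl⟩
  b_degree _ _ _ := Submodule.mem_top
  b_b _ := (rfl : _ = PUnit.unit)

instance (S : Type u) (X Y : (AInfCat.zero.{w, u, v} k S).Obj) :
    Subsingleton ((AInfCat.zero.{w, u, v} k S).Hom X Y) :=
  inferInstanceAs (Subsingleton PUnit)

/-- The unit transformation of a category with zero morphisms. -/
def AInfCat.zeroUnit (k : Type w) [CommRing k] (S : Type u) :
    (AInfCat.zero.{w, u, v} k S).UnitTransformation where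
  toCoder := Coder.zero _ _ _
  natural _ := B₁_zero _ _ _ _
  idempotent := equivalent_of_eq fun z => B₂_zero_left _ _ _ _ z
  left_invertible _ _ := ⟨0, fun _ _ _ => zero_mem _, fun _ => Subsingleton.elim _ _,
    ⟨0, fun _ _ _ => zero_mem _, fun _ => Subsingleton.elim _ _⟩,
    ⟨0, fun _ _ _ => zero_mem _, fun _ => Subsingleton.elim _ _⟩⟩
  right_invertible _ _ := ⟨0, fun _ _ _ => zero_mem _, fun _ => Subsingleton.elim _ _,
    ⟨0, fun _ _ _ => zero_mem _, fun _ => Subsingleton.elim _ _⟩,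
    ⟨0, fun _ _ _ => zero_mem _, fun _ => Subsingleton.elim _ _⟩⟩

/-- The morphism of quivers with zero components. -/
def PreFunctor.zero (A B : AInfCat.{w, u, v} k) (F : A.Obj → B.Obj) : PreFunctor A B where
  obj := F
  comp _ _ _ := 0

variable {A : AInfCat.{w, u, v} k} (i : A.UnitTransformation)

theorem whiskerLeft_ident {f g : PreFunctor A A} {d : ℤ} (r : Coder f g d) {X Y : A.Obj}
    (z : A.Tens X Y) : whiskerLeft (PreFunctor.ident A) r z = r.comp z :=
  PreFunctor.sumOver_terms_ident z (r.multilinearOn X Y)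

/-- If both units are equivalent to zero, the zero transformations in the two directions are
mutually inverse. -/
theorem isomorphic_of_zero {A B : AInfCat.{w, u, v} k} (iB : B.UnitTransformation)
    {f g : PreFunctor A B}
    (hf : Equivalent f f (whiskerLeft f iB.toCoder) fun _ _ _ => 0)
    (hg : Equivalent g g (whiskerLeft g iB.toCoder) fun _ _ _ => 0) : Isomorphic iB f g := by
  refine ⟨Coder.zero f g (-1), Coder.zero g f (-1), fun z => B₁_zero _ _ _ z,
    fun z => B₁_zero _ _ _ z, ?_, ?_⟩
  · have : B₂ (Coder.zero f g (-1)) (Coder.zero g f (-1)) = fun _ _ _ => 0 := by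
      funext X Y z; exact B₂_zero_left _ _ _ _ z
    rw [this]; exact hf.symm
  · have : B₂ (Coder.zero g f (-1)) (Coder.zero f g (-1)) = fun _ _ _ => 0 := by
      funext X Y z; exact B₂_zero_left _ _ _ _ z
    rw [this]; exact hg.symm

theorem AInfCat.b₂_zero_left {X Y Z : A.Obj} (y : A.Hom Y Z) : A.b₂ (0 : A.Hom X Y) y = 0 :=
  (A.multilinearOn_b X Z).head_zero (.single y)

theorem AInfCat.b₁_b₂_of_cycle {X Y Z : A.Obj} {x : A.Hom X Y} (hx : A.b₁ x = 0)
    (y : A.Hom Y Z) : A.b₁ (A.b₂ x y) + A.b₂ x (A.b₁ y) = 0 := by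
  have h := b₂_chain x y
  rwa [hx, b₂_zero_left, zero_add, add_comm] at h

theorem AInfCat.b₁_neg_sub_eq {X Y : A.Obj} {c e v y : A.Hom X Y} (hy : A.b₁ y + c = 0)
    (hv : c - e = A.b₁ v) : A.b₁ (-y - v) = e := by
  have h := isLinearMap_b₁ X Y
  rw [h.map_sub, h.map_neg, ← hv, ← eq_neg_of_add_eq_zero_right hy]
  abel

namespace AInfCat.UnitTransformation

theorem b₁_comp_nil (X : A.Obj) : A.b₁ (X := X) (Y := X) (i.comp (.nil X)) = 0 :=
  (B₁_nil i.toCoder X).symm.trans (i.natural _)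

/-- If the unit of `X` is a boundary, it is the boundary of an element of degree `-2`. -/
theorem exists_b₁_eq {X : A.Obj} {y : A.Hom X X} (hy : A.b₁ y = i.comp (.nil X)) :
    ∃ x ∈ A.gr X X (-2), i.comp (.nil X) = A.b₁ x := by
  have h : A.b₁ y ∈ A.gr X X (-2 + 1) := by
    rw [hy]; exact i.toCoder.comp_nil_mem X
  obtain ⟨x, hx, hxy⟩ := exists_homogeneous_b₁_eq h
  exact ⟨x, hx, (hxy.trans hy).symm⟩

/-- In a contractible category the unit transformation is equivalent to zero. -/
theorem equivalent_zero (hA : A.IsContractible) :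
    Equivalent (PreFunctor.ident A) (PreFunctor.ident A) i.comp (fun _ _ _ => 0) := by
  obtain ⟨v, hv⟩ := hA.exists_bracket_eq i.toCoder.multilinearOn i.degree
    fun z => (B₁_ident i.toCoder z).symm.trans (i.natural z)
  exact ⟨v, fun z => (sub_zero _).trans (hv z).symm⟩

/-- Units which are boundaries make the unit transformation of a functor with zero components
equivalent to zero. -/
theorem whiskerLeft_equivalent_zero {B : AInfCat.{w, u, v} k} {f : PreFunctor B A}
    (hf : ∀ {X Y : B.Obj} (z : B.Tens X Y), f.comp z = 0)
    (h : ∀ X : A.Obj, ∃ x ∈ A.gr X X (-2), i.comp (.nil X) = A.b₁ x) :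
    Equivalent f f (whiskerLeft f i.toCoder) fun _ _ _ => 0 :=
  equivalent_zero_of_comp_eq_zero hf
    (fun z hz => whiskerLeft_of_comp_eq_zero hf i.toCoder z hz)
    fun X => by
      obtain ⟨x, hx, hix⟩ := h (f.obj X)
      exact ⟨x, hx, (whiskerLeft_nil f i.toCoder X).trans hix⟩

theorem ident_whiskerLeft_equivalent_zero (hA : A.IsContractible) :
    Equivalent (PreFunctor.ident A) (PreFunctor.ident A)
      (whiskerLeft (PreFunctor.ident A) i.toCoder) fun _ _ _ => 0 := by
  have : whiskerLeft (PreFunctor.ident A) i.toCoder = i.comp := by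
    funext X Y z; exact whiskerLeft_ident i.toCoder z
  rw [this]
  exact i.equivalent_zero hA

/-- Right multiplication by `r₀` is null on cycles because the target functor of `r` kills
morphisms. Applied to the cycle `p₀`, this makes `b₂(p₀, r₀)`, which is homologous to the unit, a
boundary. -/
theorem exists_b₁_eq_of_isomorphic_zeroOf
    (h : Isomorphic i (PreFunctor.ident A) (PreFunctor.zeroOf (PreFunctor.ident A))) (X : A.Obj) :
    ∃ x ∈ A.gr X X (-2), i.comp (.nil X) = A.b₁ x := by
  obtain ⟨r, p, hr, hp, -, v, hv⟩ := h
  have h1 := (B₁_nil p X).symm.trans (hp _)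
  have h2 := hv (.nil X)
  rw [B₂_nil, B₁_nil, whiskerLeft_nil] at h2
  have hp1 : A.b₁ (X := X) (Y := X) (p.comp (.nil X)) = 0 := h1
  have hnull : ∀ x : A.Hom X X, A.b₁ x = 0 →
      A.b₁ (X := X) (Y := X) (r.comp (.single x)) + A.b₂ (Z := X) x (r.comp (.nil X)) = 0 := by
    intro x hx
    have h3 := hr (.single x)
    -- The terms are `r₀ ⊗ 0`, `r₁(x)` and `x ⊗ r₀`. The variables `r0`, `r1` carry the type `A.Hom
    -- X X`, to which the types of the components of `r` reduce only by unfolding.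
    have e1 : ∀ r0 r1 : A.Hom X X, r0 = r.comp (.nil X) → r1 = r.comp (.single x) →
        sumOver (coderTerms (PreFunctor.ident A) (PreFunctor.zeroOf (PreFunctor.ident A))
          (-1) r.comp (.single x)) (fun y => A.b y) =
        A.b₁ r1 + A.b₂ x r0 := by
      intro r0 r1 h0 h1
      have e : A.b (.cons r0 (.single (0 : A.Hom X X))) +
          (A.b (.single r1) + (A.b (.cons x (.single r0)) + 0)) = A.b₁ r1 + A.b₂ x r0 := by
        have hz : A.b (.cons r0 (.single (0 : A.Hom X X))) = 0 :=
          ((A.multilinearOn_b X X).cons r0).head_zero (.nil X)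
        rw [hz, zero_add, add_zero]
        rfl
      rw [← e, h0, h1]
      rfl
    have e2 : sumOver (derTerms A.b 1 (.single x)) (fun y => r.comp y) =
        r.comp (.cons (A.b (.nil X)) (.single (A.twist 1 x))) +
        (r.comp (.single (A.b (.single x))) + (r.comp (.cons x (.single (A.b (.nil X)))) + 0)) :=
      rfl
    have hr := r.multilinearOn X X
    have hx' : A.b (.single x) = 0 := hx
    have e3 : r.comp (.single (0 : A.Hom X X)) = 0 := hr.head_zero (.nil X)
    have e4 : r.comp (.cons x (.single (0 : A.Hom X X))) = 0 := (hr.cons x).head_zero (.nil X)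
    rw [A.b_nil, hx', e3, e4, hr.head_zero, add_zero, add_zero, add_zero] at e2
    rw [B₁, e2, smul_zero] at h3
    exact (e1 _ _ rfl rfl).symm.trans ((sub_zero _).symm.trans h3)
  exact i.exists_b₁_eq (b₁_neg_sub_eq (hnull _ hp1) h2)

/-- Unitality of `ψ` transports the vanishing unit of `O` to the objects `ψφX`, and the isomorphism
`r`, `p` carries the conclusion from `ψφX` to `X`. -/
theorem exists_b₁_eq_of_equivalentUnital {O : AInfCat.{w, u, v} k} (j : O.UnitTransformation)
    (hO : ∀ (U V : O.Obj) (x : O.Hom U V), x = 0) (h : EquivalentUnital i j) (X : A.Obj) :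
    ∃ x ∈ A.gr X X (-2), i.comp (.nil X) = A.b₁ x := by
  obtain ⟨φ, ψ, -, hψ, ⟨r, p, hr, hp, -, v, hv⟩, -⟩ := h
  obtain ⟨s, hs⟩ := hψ.unital
  have eq_of_sub : ∀ {M : Type v} [AddCommGroup M] {a b c : M}, a - b = c → b = 0 → a = c := by
    rintro M _ a _ c h rfl
    rwa [sub_zero] at h
  have h0 : whiskerRight j.toCoder ψ (.nil (φ.obj X)) = 0 := by
    rw [whiskerRight, coderTerms_nil, hO _ _ (j.comp (.nil (φ.obj X)))]
    have h := hψ.isAInfFunctor.multilinear (.nil (φ.obj X)) (.nil (φ.obj X))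
    exact List.sum_singleton.trans h.map_zero
  have h1 : whiskerLeft ψ i.toCoder (.nil (φ.obj X)) = B₁ s (.nil (φ.obj X)) := by
    exact eq_of_sub (hs _) h0
  have hi := (whiskerLeft_nil ψ i.toCoder (φ.obj X)).symm.trans (h1.trans (B₁_nil s (φ.obj X)))
  -- Contractibility is needed for morphisms from `ψφX` to `X`, where the cycle `r₀` lives.
  have hc := i.contractibleHom (s.comp_nil_mem (φ.obj X)) hi X
  have hr0 : A.b₁ (X := ψ.obj (φ.obj X)) (Y := X) (r.comp (.nil X)) = 0 :=
    (B₁_nil r X).symm.trans (hr _)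
  have hp0 : A.b₁ (X := X) (Y := ψ.obj (φ.obj X)) (p.comp (.nil X)) = 0 :=
    (B₁_nil p X).symm.trans (hp _)
  obtain ⟨q, hq⟩ := hc.acyclicHom _ hr0
  have h2 := b₁_b₂_of_cycle hp0 q
  rw [hq] at h2
  have h3 := hv (.nil X)
  rw [B₂_nil, B₁_nil, whiskerLeft_nil] at h3
  exact i.exists_b₁_eq (b₁_neg_sub_eq h2 h3)

/-- `O` has the objects of `A`, and both functors are the identity on objects with zero components.
The unit conditions reduce to units being equivalent to zero. -/
theorem exists_equivalentUnital (hA : A.IsContractible)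
    (h : ∀ X : A.Obj, ∃ x ∈ A.gr X X (-2), i.comp (.nil X) = A.b₁ x) :
    ∃ (O : AInfCat.{w, u, v} k) (j : O.UnitTransformation),
      (∀ (U V : O.Obj) (x : O.Hom U V), x = 0) ∧ EquivalentUnital i j := by
  let O := AInfCat.zero.{w, u, v} k A.Obj
  let j : O.UnitTransformation := AInfCat.zeroUnit k A.Obj
  have hO : ∀ (U V : O.Obj) (x y : O.Hom U V), x = y := fun _ _ _ _ => rfl
  let φ : PreFunctor A O := PreFunctor.zero A O fun X => X
  let ψ : PreFunctor O A := PreFunctor.zero O A fun X => X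
  have hO' : ∀ {f : PreFunctor O O}, Equivalent f f (whiskerLeft f j.toCoder) fun _ _ _ => 0 :=
    equivalent_of_eq fun z => hO _ _ _ _
  refine ⟨O, j, fun _ _ _ => hO _ _ _ _, φ, ψ,
    ⟨isAInfFunctor_of_comp_eq_zero fun _ => rfl, equivalent_of_eq fun z => hO _ _ _ _⟩,
    ⟨isAInfFunctor_of_comp_eq_zero fun _ => rfl, ?_⟩,
    isomorphic_of_zero i (i.whiskerLeft_equivalent_zero (fun z => sumOver_eq_zero _ fun _ _ => rfl) h)
      (i.ident_whiskerLeft_equivalent_zero hA),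
    isomorphic_of_zero j hO' hO'⟩
  have hw : whiskerRight j.toCoder ψ = fun _ _ _ => 0 := by
    funext X Y z
    exact sumOver_eq_zero _ fun _ _ => rfl
  rw [hw]
  exact i.whiskerLeft_equivalent_zero (fun _ => rfl) h

end AInfCat.UnitTransformation

end AInf

theorem mainTheorem12 {k : Type w} [CommRing k] (A : AInf.AInfCat.{w, u, v} k)
    (i : A.UnitTransformation) :
    List.TFAE [
      A.IsContractible,
      ∃ (O : AInf.AInfCat.{w, u, v} k) (j : O.UnitTransformation),
        (∀ (U V : O.Obj) (x : O.Hom U V), x = 0) ∧ AInf.EquivalentUnital i j,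
      ∀ X Y : A.Obj, A.ContractibleHom X Y,
      ∀ X : A.Obj, A.ContractibleHom X X,
      ∀ X : A.Obj, A.AcyclicHom X X,
      ∀ X : A.Obj, ∃ x ∈ A.gr X X (-2), i.comp (.nil X) = A.b₁ x,
      AInf.Equivalent (AInf.PreFunctor.ident A) (AInf.PreFunctor.ident A) i.comp
        (fun _ _ _ => 0),
      AInf.Isomorphic i (AInf.PreFunctor.ident A)
        (AInf.PreFunctor.zeroOf (AInf.PreFunctor.ident A))] := by
  -- Contractibility and the boundary condition on units are linked first; every other condition is
  -- then placed between them.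
  have h56 : (∀ X : A.Obj, ∃ x ∈ A.gr X X (-2), i.comp (.nil X) = A.b₁ x) →
      A.IsContractible := fun h X Y => by
    obtain ⟨x, hx, hi⟩ := h X
    exact i.contractibleHom hx hi Y
  have h65 : A.IsContractible → ∀ X : A.Obj, ∃ x ∈ A.gr X X (-2), i.comp (.nil X) = A.b₁ x :=
    fun h X => by
      obtain ⟨y, hy⟩ := (h X X).acyclicHom _ (i.b₁_comp_nil X)
      exact i.exists_b₁_eq hy
  tfae_have 1 ↔ 3 := Iff.rfl
  tfae_have 3 → 4 := fun h X => h X X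
  tfae_have 4 → 5 := fun h X => (h X).acyclicHom
  tfae_have 5 → 6 := fun h X => by
    obtain ⟨y, hy⟩ := h X _ (i.b₁_comp_nil X)
    exact i.exists_b₁_eq hy
  tfae_have 6 → 1 := h56
  tfae_have 1 → 7 := i.equivalent_zero
  tfae_have 7 → 6 := fun ⟨v, hv⟩ X =>
    ⟨v.comp (.nil X), v.comp_nil_mem X,
      (sub_zero _).symm.trans ((hv (.nil X)).trans (AInf.B₁_nil v X))⟩
  tfae_have 1 → 8 := fun h => AInf.isomorphic_of_zero i (i.ident_whiskerLeft_equivalent_zero h)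
    (i.whiskerLeft_equivalent_zero (fun _ => rfl) (h65 h))
  tfae_have 8 → 6 := i.exists_b₁_eq_of_isomorphic_zeroOf
  tfae_have 1 → 2 := fun h => i.exists_equivalentUnital h (h65 h)
  tfae_have 2 → 6 := fun ⟨_, j, hO, h⟩ => i.exists_b₁_eq_of_equivalentUnital j hO h
  tfae_finish
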